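/- Let $\Omega=(a,b)\subset\mathbb{R}$ be a bounded open interval. There is a constant $c\ge 0$ depending only on $\Omega$ such that the following holds. Let $\alpha>0$, let $\Gamma_D\subseteq\partial\Omega=\{a,b\}$ (possibly empty), let $g\in L^\infty(\Omega)$, and let $$I(v)=|Dv|(\Omega)+\frac{\alpha}{2}\|g-v\|_{L^2(\Omega)}^2 .$$ Let $u$ be a minimizer of $I$ among all $v\in BV(\Omega)\cap L^2(\Omega)$ whose trace vanishes on $\Gamma_D$, and let $J_u\subset\Omega$ be its (approximate) jump set. Assume that $u$ is piecewise $W^{2,1}$, i.e., $u\in W^{2,1}(\Omega\setminus P)$ for some finite set $P$, and let $u''\in L^1(\Omega\setminus P)$ be its piecewise second weak derivative. Let $\beta\ge 1$, let $J\ge 1$ be an integer, and put $h=1/J$. Let $\mathcal{T}_h$ be a mesh of $\overline\Omega$ that is graded with strength $\beta$ towards $J_u$: there are macro elements $[m_{k-1},m_k]$, $k=1,\dots,M$, with $a=m_0<m_1<\dots<m_M=b$, such that every point of $J_u$ is one of the $m_k$. Each macro element carries the image of the grid $\{(j/J)^\beta: j=0,\dots,J\}$ of $[0,1]$ under an affine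 bijection of $[0,1]$ onto it, which maps $0$ to the end point belonging to $J_u$ if there is one, and not both end points belong to $J_u$; a macro element without end point in $J_u$ may instead carry the uniform grid with $J$ subintervals. Assume finally that the points of $(P\cap\Omega)\setminus J_u$ (at which $u'$ but not $u$ may jump) are vertices of $\mathcal{T}_h$; this is void if $u\in W^{2,1}(\Omega\setminus J_u)$, where one takes $P=J_u$. Let $u_h$ be a minimizer of $I$ in the space $\mathcal{S}^1_D(\mathcal{T}_h)$ of continuous functions on $\overline\Omega$ that are affine on every element of $\mathcal{T}_h$ and vanish on $\Gamma_D$. Then $$\|u-u_h\|_{L^2(\Omega)}^2\le c\,\Bigl(h^\beta\,|Du|(\Omega)+\beta^2h^2\,\|u''\|_{L^1(\Omega\setminus J_u)}\Bigr)\,\|g\|_{L^\infty(\Omega)} .$$ -/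

import Mathlib

open MeasureTheory Set Filter Topology
open scoped ENNReal NNReal ContDiff

noncomputable section

namespace ROF1D

/-- `φ ∈ C_c^∞(U)`. -/
def IsTestFunction (U : Set ℝ) (φ : ℝ → ℝ) : Prop :=
  ContDiff ℝ ∞ φ ∧ HasCompactSupport φ ∧ tsupport φ ⊆ U

/-- The total variation `|Dv|(a,b) = sup { -∫ v φ' : φ ∈ C_c^∞(a,b), |φ| ≤ 1 }`. -/
def totalVariation (a b : ℝ) (v : ℝ → ℝ) : ℝ≥0∞ :=
  ⨆ φ ∈ {φ : ℝ → ℝ | IsTestFunction (Ioo a b) φ ∧ ∀ x, |φ x| ≤ 1},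
    ENNReal.ofReal (-∫ x in Ioo a b, v x * deriv φ x)

/-- `v ∈ BV(a,b)`: integrable and of finite total variation. -/
def MemBV (a b : ℝ) (v : ℝ → ℝ) : Prop :=
  MemLp v 1 (volume.restrict (Ioo a b)) ∧ totalVariation a b v < (⊤ : ℝ≥0∞)

/-- `t` is the (approximate) limit of `v` at `x` from the right. At the left end point of the
domain this is the trace of `v`. It does not depend on the representative of `v`. -/
def HasRightTrace (v : ℝ → ℝ) (x t : ℝ) : Prop :=
  Tendsto (fun r : ℝ => ⨍ y in Ioo x (x + r), |v y - t|) (𝓝[>] 0) (𝓝 0)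

/-- `t` is the (approximate) limit of `v` at `x` from the left. -/
def HasLeftTrace (v : ℝ → ℝ) (x t : ℝ) : Prop :=
  Tendsto (fun r : ℝ => ⨍ y in Ioo (x - r) x, |v y - t|) (𝓝[>] 0) (𝓝 0)

/-- The (approximate) jump set `J_v` of `v` in `(a,b)`. -/
def jumpSet (a b : ℝ) (v : ℝ → ℝ) : Set ℝ :=
  {x ∈ Ioo a b | ∃ s t : ℝ, s ≠ t ∧ HasLeftTrace v x s ∧ HasRightTrace v x t}

/-- `w` is the weak derivative of `v` on the open set `U`. -/
def HasWeakDeriv (U : Set ℝ) (v w : ℝ → ℝ) : Prop :=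
  ∀ φ : ℝ → ℝ, IsTestFunction U φ → ∫ x in U, v x * deriv φ x = -∫ x in U, w x * φ x

/-- `v ∈ W^{2,1}(U)` with second weak derivative `w`, for an open set `U`. -/
def MemW21 (U : Set ℝ) (v w : ℝ → ℝ) : Prop :=
  MemLp v 1 (volume.restrict U) ∧ MemLp w 1 (volume.restrict U) ∧
    ∃ v₁ : ℝ → ℝ, MemLp v₁ 1 (volume.restrict U) ∧ HasWeakDeriv U v v₁ ∧ HasWeakDeriv U v₁ w

/-- The Rudin-Osher-Fatemi functional `I(v) = |Dv|(a,b) + (α/2) ‖g - v‖²` with the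
`L²(a,b)` norm. -/
def energy (a b α : ℝ) (g v : ℝ → ℝ) : ℝ≥0∞ :=
  totalVariation a b v +
    ENNReal.ofReal (α / 2) * eLpNorm (fun x => g x - v x) 2 (volume.restrict (Ioo a b)) ^ 2

/-- The functions in `BV(a,b) ∩ L²(a,b)` with zero trace on the Dirichlet boundary
`Γ ⊆ {a, b}`. -/
def admissible (a b : ℝ) (Γ : Set ℝ) : Set (ℝ → ℝ) :=
  {v | MemBV a b v ∧ MemLp v 2 (volume.restrict (Ioo a b)) ∧
    (a ∈ Γ → HasRightTrace v a 0) ∧ (b ∈ Γ → HasLeftTrace v b 0)}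

/-- `u` minimizes `I` among the functions in `BV(a,b) ∩ L²(a,b)` that vanish on `Γ`. -/
def IsMinimizer (a b α : ℝ) (Γ : Set ℝ) (g u : ℝ → ℝ) : Prop :=
  u ∈ admissible a b Γ ∧ IsMinOn (energy a b α g) (admissible a b Γ) u

/-- The `P1` finite element space on the mesh of `[a,b]` with vertex set `N`: continuous functions
which are affine between any two consecutive vertices, and which vanish on `Γ`. -/
def p1Space (a b : ℝ) (Γ N : Set ℝ) : Set (ℝ → ℝ) :=
  {v | ContinuousOn v (Icc a b) ∧
    (∀ p ∈ N, ∀ q ∈ N, p < q → Disjoint (Ioo p q) N →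
      ∃ m d : ℝ, ∀ x ∈ Icc p q, v x = m * x + d) ∧
    ∀ x ∈ Γ, v x = 0}

/-- `u_h` minimizes `I` over the `P1` finite element space. -/
def IsP1Minimizer (a b α : ℝ) (Γ N : Set ℝ) (g uh : ℝ → ℝ) : Prop :=
  uh ∈ p1Space a b Γ N ∧ IsMinOn (energy a b α g) (p1Space a b Γ N) uh

/-- The points `(j/J)^β`, `j = 0, …, J`, of the `β`-graded grid of the reference element `[0,1]`. -/
def referenceGrid (β : ℝ) (J : ℕ) : Set ℝ :=
  {ξ | ∃ j : ℕ, j ≤ J ∧ ξ = ((j : ℝ) / (J : ℝ)) ^ β}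

/-- The image of the `β`-graded reference grid under the affine map `0 ↦ p`, `1 ↦ q`: a grid of the
interval between `p` and `q` that is graded towards `p`. -/
def gradedGrid (β : ℝ) (J : ℕ) (p q : ℝ) : Set ℝ :=
  AffineMap.lineMap p q '' referenceGrid β J

/-- `N` is the vertex set of a mesh of `[a,b]` that is graded with strength `β` and mesh-size
`h = 1/J` towards `S`. There are macro elements `[m_k, m_{k+1}]` such that every point of `S` is
one of the `m_k`, and each macro element carries a `β`-graded grid graded towards one of its end
points, the other one not belonging to `S`; a macro element without end point in `S` may
also carry the uniform grid. -/
def IsGradedMesh (a b β : ℝ) (J : ℕ) (S N : Set ℝ) : Prop :=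
  ∃ (M : ℕ) (m : Fin (M + 1) → ℝ) (G : Fin M → Set ℝ),
    StrictMono m ∧ m 0 = a ∧ m (Fin.last M) = b ∧ S ⊆ range m ∧
    (∀ k : Fin M,
      (G k = gradedGrid β J (m k.castSucc) (m k.succ) ∧ m k.succ ∉ S) ∨
      (G k = gradedGrid β J (m k.succ) (m k.castSucc) ∧ m k.castSucc ∉ S) ∨
      (G k = gradedGrid 1 J (m k.castSucc) (m k.succ) ∧ m k.castSucc ∉ S ∧ m k.succ ∉ S)) ∧
    N = ⋃ k : Fin M, G k

end ROF1D

end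

noncomputable section

namespace ROF1D

/-! Let `G` be the sup norm of `g`, `L = b - a`, and `I_h u` the nodal interpolant of a good
representative of `u`. Strong convexity of the fidelity term and minimality of `u_h` give `α/4 ‖u -
u_h‖² ≤ I(u_h) - I(u) ≤ I(I_h u) - I(u)` (`IsMinimizer.integral_sq_le`). Nodal interpolation does
not increase the total variation, since the variation of `I_h u` is just one partition sum for the
representative (`IsGoodRepresentative.totalVariation_interpolant_le`). So only the fidelity
difference remains. As `u` and `I_h u` are bounded by `G` (`IsMinimizer.ae_abs_le`, by truncation),
it is at most `α/2 · 4G ‖u - I_h u‖` in the `L¹` norm. The weight `α` cancels, leaving `‖u - u_h‖² ≤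
8G ‖u - I_h u‖_{L¹}`.

The `L¹` error is local (`IsGoodRepresentative.lintegral_sub_interpolant_le`). On an element
touching the jump set it is at most the length times the local variation, and grading makes that
length at most `L h^β`. On any other element `u` is `C¹`, the error is at most the squared length
times `∫ |u''|`, and the length is at most `L β h` (`IsGradedMesh.length_le`).

Total variation is defined by duality, whereas interpolation and truncation are controlled through
pointwise variation. The two agree for the one-sided continuous, piecewise `C¹` representative
(`eVariationOn_le_totalVariation`, `totalVariation_le_eVariationOn`). -/

/-! ### Test functions and weak derivatives -/

lemma IsTestFunction.mono {U V : Set ℝ} {φ : ℝ → ℝ} (h : IsTestFunction U φ) (hUV : U ⊆ V) :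
    IsTestFunction V φ :=
  ⟨h.1, h.2.1, h.2.2.trans hUV⟩

lemma IsTestFunction.eq_zero {U : Set ℝ} {φ : ℝ → ℝ} (h : IsTestFunction U φ) {x : ℝ}
    (hx : x ∉ U) : φ x = 0 :=
  image_eq_zero_of_notMem_tsupport fun hx' => hx (h.2.2 hx')

lemma IsTestFunction.deriv_eq_zero {U : Set ℝ} {φ : ℝ → ℝ} (h : IsTestFunction U φ) {x : ℝ}
    (hx : x ∉ U) : deriv φ x = 0 :=
  image_eq_zero_of_notMem_tsupport fun hx' => hx (h.2.2 (tsupport_deriv_subset hx'))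

lemma IsTestFunction.differentiable {U : Set ℝ} {φ : ℝ → ℝ} (h : IsTestFunction U φ) :
    Differentiable ℝ φ :=
  h.1.differentiable (by simp)

lemma IsTestFunction.continuous_deriv {U : Set ℝ} {φ : ℝ → ℝ} (h : IsTestFunction U φ) :
    Continuous (deriv φ) :=
  h.1.continuous_deriv (by simp)

lemma IsTestFunction.exists_deriv_bound {U : Set ℝ} {φ : ℝ → ℝ} (h : IsTestFunction U φ) :
    ∃ C, ∀ x, |deriv φ x| ≤ C :=
  h.continuous_deriv.bounded_above_of_compact_support h.2.1.deriv

lemma IsTestFunction.integrable_mul_deriv {U V : Set ℝ} {φ v : ℝ → ℝ} (h : IsTestFunction U φ)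
    (hv : IntegrableOn v V) : IntegrableOn (fun x => v x * deriv φ x) V := by
  obtain ⟨C, hC⟩ := h.exists_deriv_bound
  exact hv.mul_bdd h.continuous_deriv.aestronglyMeasurable (Eventually.of_forall hC)

lemma IsTestFunction.integrable_mul {U V : Set ℝ} {φ v : ℝ → ℝ} (h : IsTestFunction U φ)
    (hv : IntegrableOn v V) : IntegrableOn (fun x => v x * φ x) V := by
  obtain ⟨C, hC⟩ := h.1.continuous.bounded_above_of_compact_support h.2.1
  exact hv.mul_bdd h.1.continuous.aestronglyMeasurable (Eventually.of_forall hC)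

lemma HasWeakDeriv.mono {U V : Set ℝ} {v w : ℝ → ℝ} (h : HasWeakDeriv V v w) (hUV : U ⊆ V)
    (hV : MeasurableSet V) : HasWeakDeriv U v w := by
  intro φ hφ
  have h1 := h φ (hφ.mono hUV)
  rw [setIntegral_eq_of_subset_of_forall_sdiff_eq_zero hV hUV,
    setIntegral_eq_of_subset_of_forall_sdiff_eq_zero hV hUV] at h1
  · exact h1
  · intro x hx
    simp [hφ.eq_zero hx.2]
  · intro x hx
    simp [hφ.deriv_eq_zero hx.2]

/-! ### Regular representatives of `W^{2,1}` functions -/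

lemma exists_Icc_of_isCompact_subset_Ioo {p q : ℝ} (hpq : p < q) {K : Set ℝ} (hK : IsCompact K)
    (hKs : K ⊆ Ioo p q) : ∃ p' q', p < p' ∧ p' < q' ∧ q' < q ∧ K ⊆ Icc p' q' := by
  -- The midpoint is added only to have a nonempty compact set, which has a least and a greatest
  -- element.
  have hK' : IsCompact (insert ((p + q) / 2) K) := hK.insert _
  have hsub : insert ((p + q) / 2) K ⊆ Ioo p q :=
    insert_subset ⟨by linarith, by linarith⟩ hKs
  obtain ⟨s, hs, hs'⟩ := hK'.exists_isLeast (insert_nonempty _ _)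
  obtain ⟨t, ht, ht'⟩ := hK'.exists_isGreatest (insert_nonempty _ _)
  refine ⟨(p + s) / 2, (t + q) / 2, ?_, ?_, ?_, fun x hx => ⟨?_, ?_⟩⟩
  · linarith [(hsub hs).1]
  · linarith [hs' ht, (hsub hs).1, (hsub ht).2]
  · linarith [(hsub ht).2]
  · linarith [hs' (mem_insert_of_mem _ hx), (hsub hs).1]
  · linarith [ht' (mem_insert_of_mem _ hx), (hsub ht).2]

/-- A test function of zero mean is the derivative of a test function. -/
lemma IsTestFunction.exists_primitive {p q : ℝ} (hpq : p < q) {φ : ℝ → ℝ}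
    (hφ : IsTestFunction (Ioo p q) φ) (h0 : ∫ x in Ioo p q, φ x = 0) :
    ∃ ψ, IsTestFunction (Ioo p q) ψ ∧ deriv ψ = φ := by
  obtain ⟨p', q', hp, hpq', hq, hK⟩ := exists_Icc_of_isCompact_subset_Ioo hpq hφ.2.1 hφ.2.2
  have hd : ∀ x, HasDerivAt (fun x => ∫ t in p..x, φ t) (φ x) x := fun x =>
    (hφ.1.continuous).integral_hasStrictDerivAt p x |>.hasDerivAt
  have hderiv : deriv (fun x => ∫ t in p..x, φ t) = φ := funext fun x => (hd x).deriv
  have hzero : ∀ x, x ∉ Icc p' q' → φ x = 0 := fun x hx =>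
    image_eq_zero_of_notMem_tsupport fun h => hx (hK h)
  have hsupp : Function.support (fun x => ∫ t in p..x, φ t) ⊆ Icc p' q' := by
    intro x hx
    by_contra hx'
    apply hx
    rw [mem_Icc, not_and_or, not_le, not_le] at hx'
    rcases hx' with h | h
    · apply intervalIntegral.integral_zero_ae
      refine Eventually.of_forall fun t ht => hzero t fun h' => ?_
      rcases (mem_uIoc.1 ht) with h'' | h'' <;> linarith [h'.1, h''.2]
    -- To the right of the support the primitive equals the full integral, so this is where zero
    -- mean enters.
    · have h1 : ∫ t in p..q, φ t = 0 := by
        rw [intervalIntegral.integral_of_le hpq.le, integral_Ioc_eq_integral_Ioo, h0]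
      have h2 : ∫ t in q..x, φ t = 0 := by
        apply intervalIntegral.integral_zero_ae
        refine Eventually.of_forall fun t ht => hzero t fun h' => ?_
        rcases (mem_uIoc.1 ht) with h'' | h'' <;> linarith [h'.2, h''.1]
      have h3 := intervalIntegral.integral_add_adjacent_intervals
        (hφ.1.continuous.intervalIntegrable (μ := volume) p q)
        (hφ.1.continuous.intervalIntegrable (μ := volume) q x)
      rw [h1, h2, add_zero] at h3
      exact h3.symm
  have hts : tsupport (fun x => ∫ t in p..x, φ t) ⊆ Icc p' q' := closure_minimal hsupp isClosed_Icc
  refine ⟨_, ⟨?_, HasCompactSupport.of_support_subset_isCompact isCompact_Icc hsupp,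
    hts.trans fun x hx => ⟨hp.trans_le hx.1, hx.2.trans_lt hq⟩⟩, hderiv⟩
  rw [contDiff_infty_iff_deriv, hderiv]
  exact ⟨fun x => (hd x).differentiableAt, hφ.1⟩

lemma exists_isTestFunction_integral_eq_one {p q : ℝ} (hpq : p < q) :
    ∃ η, IsTestFunction (Ioo p q) η ∧ ∫ x in Ioo p q, η x = 1 := by
  let B : ContDiffBump ((p + q) / 2) := ⟨(q - p) / 8, (q - p) / 4, by linarith, by linarith⟩
  have hs : tsupport (B.normed volume) ⊆ Ioo p q := by
    rw [B.tsupport_normed_eq, Real.closedBall_eq_Icc]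
    intro x hx
    have h1 : B.rOut = (q - p) / 4 := rfl
    rw [h1] at hx
    exact ⟨by linarith [hx.1], by linarith [hx.2]⟩
  refine ⟨B.normed volume, ⟨B.contDiff_normed, B.hasCompactSupport_normed, hs⟩, ?_⟩
  rw [setIntegral_eq_integral_of_forall_compl_eq_zero, B.integral_normed]
  exact fun x hx => image_eq_zero_of_notMem_tsupport fun h => hx (hs h)

/-- The lemma of du Bois-Reymond. -/
lemma exists_ae_eq_const_of_integral_mul_deriv_eq_zero {p q : ℝ} (hpq : p < q) {v : ℝ → ℝ}
    (hv : IntegrableOn v (Ioo p q))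
    (h : ∀ φ, IsTestFunction (Ioo p q) φ → ∫ x in Ioo p q, v x * deriv φ x = 0) :
    ∃ c, ∀ᵐ x ∂volume.restrict (Ioo p q), v x = c := by
  obtain ⟨η, hη, hη1⟩ := exists_isTestFunction_integral_eq_one hpq
  set c := ∫ x in Ioo p q, v x * η x with hc
  have hcI : IntegrableOn (fun _ => c) (Ioo p q) := by simp
  have h1I : IntegrableOn (fun _ => (1 : ℝ)) (Ioo p q) := by simp
  have key := isOpen_Ioo.ae_eq_zero_of_integral_contDiff_smul_eq_zero (μ := volume)
    (f := fun x => v x - c) (hv.sub hcI).locallyIntegrableOn ?_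
  · refine ⟨c, ?_⟩
    rw [ae_restrict_iff' measurableSet_Ioo]
    filter_upwards [key] with x hx hx'
    linarith [hx hx']
  · intro g hg hgc hgs
    have hgt : IsTestFunction (Ioo p q) g := ⟨hg, hgc, hgs⟩
    have hgI : IntegrableOn g (Ioo p q) := by simpa using hgt.integrable_mul h1I
    have hηI : IntegrableOn η (Ioo p q) := by simpa using hη.integrable_mul h1I
    set m := ∫ x in Ioo p q, g x with hm
    -- Subtracting `m η` removes the mean of `g`, so the difference is the derivative of a test
    -- function. This forces the constant to be `c = ∫ v η`.
    have htest : IsTestFunction (Ioo p q) (fun x => g x - m * η x) := by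
      refine ⟨hg.sub (contDiff_const.mul hη.1), hgc.sub hη.2.1.mul_left, ?_⟩
      refine (tsupport_sub _ _).trans (union_subset hgs ?_)
      exact (tsupport_mul_subset_right).trans hη.2.2
    obtain ⟨ψ, hψ, hψ'⟩ := htest.exists_primitive hpq (by
      rw [integral_sub hgI (hηI.const_mul m), integral_const_mul, hη1]; simp [hm])
    have h2 := h ψ hψ
    rw [hψ'] at h2
    have h3 : ∫ x in Ioo p q, v x * (g x - m * η x)
        = (∫ x in Ioo p q, v x * g x) - m * c := by
      rw [hc, ← integral_const_mul, ← integral_sub (hgt.integrable_mul hv)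
        ((hη.integrable_mul hv).const_mul m)]
      exact integral_congr_ae (Eventually.of_forall fun x => by ring)
    have h4 : ∫ x, g x • (v x - c) = ∫ x in Ioo p q, (v x * g x - c * g x) := by
      rw [← setIntegral_eq_integral_of_forall_compl_eq_zero (s := Ioo p q)]
      · exact integral_congr_ae (Eventually.of_forall fun x => by simp; ring)
      · exact fun x hx => by simp [hgt.eq_zero hx]
    rw [h4, integral_sub (hgt.integrable_mul hv) (hgI.const_mul c), integral_const_mul]
    linarith

/-- The primitive of `w` is absolutely continuous, so integration by parts shows that `w` is also
its weak derivative; du Bois-Reymond applies to the difference with `v`. -/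
lemma HasWeakDeriv.exists_ae_eq_add_integral {p q : ℝ} (hpq : p < q) {v w : ℝ → ℝ}
    (hv : IntegrableOn v (Ioo p q)) (hw : IntegrableOn w (Ioo p q))
    (h : HasWeakDeriv (Ioo p q) v w) :
    ∃ c, ∀ᵐ x ∂volume.restrict (Ioo p q), v x = c + ∫ t in p..x, w t := by
  have hwi : IntervalIntegrable w volume p q := by
    rw [intervalIntegrable_iff_integrableOn_Ioo_of_le hpq.le]; exact hw
  have hac := hwi.absolutelyContinuousOnInterval_intervalIntegral (c := p) left_mem_uIcc
  have hWI : IntegrableOn (fun x => ∫ t in p..x, w t) (Ioo p q) := by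
    have := hac.continuousOn.integrableOn_compact isCompact_uIcc (μ := volume)
    exact this.mono_set (Ioo_subset_Icc_self.trans Icc_subset_uIcc)
  obtain ⟨c, hc⟩ := exists_ae_eq_const_of_integral_mul_deriv_eq_zero hpq (hv.sub hWI) (by
    intro φ hφ
    have hφac : AbsolutelyContinuousOnInterval φ p q :=
      (hφ.1.of_le (by simp)).contDiffOn.absolutelyContinuousOnInterval
    have h1 := hac.integral_mul_deriv_eq_deriv_mul hφac
    rw [hφ.eq_zero (x := q) (by simp), hφ.eq_zero (x := p) (by simp)] at h1
    have h2 : ∫ x in p..q, deriv (fun x => ∫ t in p..x, w t) x * φ x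
        = ∫ x in p..q, w x * φ x := by
      apply intervalIntegral.integral_congr_ae
      filter_upwards [hwi.ae_hasDerivAt_integral] with x hx hx'
      rw [(hx (uIoc_subset_uIcc hx') p left_mem_uIcc).deriv]
    rw [h2] at h1
    simp only [intervalIntegral.integral_of_le hpq.le, integral_Ioc_eq_integral_Ioo] at h1
    have h3 := h φ hφ
    simp only [Pi.sub_apply, sub_mul]
    rw [integral_sub (hφ.integrable_mul_deriv hv) (hφ.integrable_mul_deriv hWI)]
    linarith)
  exact ⟨c, hc.mono fun x hx => by simp only [Pi.sub_apply] at hx; linarith⟩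

/-- A function that is `W^{2,1}` near `(p,q)` agrees on `(p,q)` with a `C¹` function, the oscillation
of whose derivative is controlled by the second weak derivative. -/
lemma MemW21.exists_regular_representative {U : Set ℝ} {u w : ℝ → ℝ} (h : MemW21 U u w)
    (hU : MeasurableSet U) {p q : ℝ} (hpq : p < q) (hs : Ioo p q ⊆ U) :
    ∃ f V : ℝ → ℝ, (∀ x, HasDerivAt f (V x) x) ∧ u =ᵐ[volume.restrict (Ioo p q)] f ∧
      ∀ x y, ‖V x - V y‖ₑ ≤ ∫⁻ t in Ioo p q, ‖w t‖ₑ := by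
  obtain ⟨hu, hw, v, hv, huv, hvw⟩ := h
  have huI : IntegrableOn u (Ioo p q) := IntegrableOn.mono_set (memLp_one_iff_integrable.1 hu) hs
  have hvI : IntegrableOn v (Ioo p q) := IntegrableOn.mono_set (memLp_one_iff_integrable.1 hv) hs
  have hwI : IntegrableOn w (Ioo p q) := IntegrableOn.mono_set (memLp_one_iff_integrable.1 hw) hs
  obtain ⟨c₀, hc₀⟩ := (huv.mono hs hU).exists_ae_eq_add_integral hpq huI hvI
  obtain ⟨c₁, hc₁⟩ := (hvw.mono hs hU).exists_ae_eq_add_integral hpq hvI hwI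
  set w' := (Ioo p q).indicator w with hw'
  have hw'I : Integrable w' := hwI.integrable_indicator measurableSet_Ioo
  set V : ℝ → ℝ := fun x => c₁ + ∫ t in p..x, w' t with hV
  have hVc : Continuous V := by
    exact continuous_const.add (intervalIntegral.continuous_primitive
      (fun _ _ => hw'I.intervalIntegrable) p)
  have hww : ∀ x ∈ Ioo p q, ∫ t in p..x, w t = ∫ t in p..x, w' t := by
    intro x hx
    apply intervalIntegral.integral_congr_ae
    refine Eventually.of_forall fun t ht => ?_
    rw [uIoc_of_le hx.1.le] at ht
    exact (indicator_of_mem (show t ∈ Ioo p q from ⟨ht.1, ht.2.trans_lt hx.2⟩) w).symm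
  have hvV : ∀ᵐ x ∂volume.restrict (Ioo p q), v x = V x := by
    filter_upwards [hc₁, ae_restrict_mem measurableSet_Ioo] with x hx hx'
    rw [hx, hww x hx']
  refine ⟨fun x => c₀ + ∫ t in p..x, V t, V, fun x => ?_, ?_, fun x y => ?_⟩
  · simpa using (hVc.integral_hasStrictDerivAt p x).hasDerivAt.const_add c₀
  · filter_upwards [hc₀, ae_restrict_mem measurableSet_Ioo] with x hx hx'
    rw [hx]
    congr 1
    rw [intervalIntegral.integral_of_le hx'.1.le, intervalIntegral.integral_of_le hx'.1.le,
      integral_Ioc_eq_integral_Ioo, integral_Ioc_eq_integral_Ioo]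
    exact integral_congr_ae (ae_restrict_of_ae_restrict_of_subset
      (Ioo_subset_Ioo_right hx'.2.le) hvV)
  · have h1 : V x - V y = ∫ t in y..x, w' t := by
      have := intervalIntegral.integral_add_adjacent_intervals
        (hw'I.intervalIntegrable (a := p) (b := y)) (hw'I.intervalIntegrable (a := y) (b := x))
      simp only [hV]; linarith
    rw [h1, ← lintegral_indicator measurableSet_Ioo]
    have h2 : ∀ t, (Ioo p q).indicator (fun t => ‖w t‖ₑ) t = ‖w' t‖ₑ := fun t => by
      by_cases ht : t ∈ Ioo p q <;> simp [hw', ht]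
    simp_rw [h2]
    have h3 : ‖∫ t in y..x, w' t‖ₑ = ‖∫ t in uIoc y x, w' t‖ₑ := by
      rw [← ofReal_norm, intervalIntegral.norm_integral_eq_norm_integral_uIoc, ofReal_norm]
    rw [h3]
    exact (enorm_integral_le_lintegral_enorm _).trans (setLIntegral_le_lintegral _ _)

/-! ### Total variation by duality and pointwise variation -/

/-- A smooth monotone step from `0` to `1` which takes place in `[y + ε, y + 2 ε]`. -/
def smoothStep (ε y x : ℝ) : ℝ := Real.smoothTransition ((x - y) / ε - 1)

lemma contDiff_smoothStep (ε y : ℝ) : ContDiff ℝ ∞ (smoothStep ε y) :=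
  Real.smoothTransition.contDiff.comp (((contDiff_id.sub contDiff_const).div_const _).sub
    contDiff_const)

lemma smoothStep_eq_zero {ε y x : ℝ} (hε : 0 < ε) (h : x ≤ y + ε) : smoothStep ε y x = 0 := by
  apply Real.smoothTransition.zero_of_nonpos
  rw [sub_nonpos, div_le_one hε]; linarith

lemma smoothStep_eq_one {ε y x : ℝ} (hε : 0 < ε) (h : y + 2 * ε ≤ x) : smoothStep ε y x = 1 := by
  apply Real.smoothTransition.one_of_one_le
  rw [le_sub_iff_add_le, le_div_iff₀ hε]; linarith

lemma monotone_smoothStep {ε : ℝ} (hε : 0 < ε) (y : ℝ) : Monotone (smoothStep ε y) := by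
  intro x x' h
  apply Real.smoothTransition.monotone
  gcongr

lemma smoothStep_antitone_left {ε : ℝ} (hε : 0 < ε) (x : ℝ) :
    Antitone fun y => smoothStep ε y x := by
  intro y y' h
  apply Real.smoothTransition.monotone
  gcongr

lemma deriv_smoothStep_eq_zero {ε y x : ℝ} (hε : 0 < ε) (h : x ∉ Icc (y + ε) (y + 2 * ε)) :
    deriv (smoothStep ε y) x = 0 := by
  rw [mem_Icc, not_and_or, not_le, not_le] at h
  rcases h with h | h
  · have : smoothStep ε y =ᶠ[𝓝 x] fun _ => 0 := by
      filter_upwards [Iio_mem_nhds h] with z hz using smoothStep_eq_zero hε (le_of_lt hz)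
    rw [this.deriv_eq]; simp
  · have : smoothStep ε y =ᶠ[𝓝 x] fun _ => 1 := by
      filter_upwards [Ioi_mem_nhds h] with z hz using smoothStep_eq_one hε (le_of_lt hz)
    rw [this.deriv_eq]; simp

lemma continuous_deriv_smoothStep (ε y : ℝ) : Continuous (deriv (smoothStep ε y)) :=
  (contDiff_smoothStep ε y).continuous_deriv (by simp)

lemma integrableOn_mul_deriv_smoothStep {a b ε : ℝ} (hε : 0 < ε) {v : ℝ → ℝ}
    (hv : IntegrableOn v (Ioo a b)) (y : ℝ) :
    IntegrableOn (fun x => v x * deriv (smoothStep ε y) x) (Ioo a b) := by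
  have hc : HasCompactSupport (deriv (smoothStep ε y)) :=
    HasCompactSupport.intro isCompact_Icc fun x hx => deriv_smoothStep_eq_zero hε hx
  obtain ⟨C, hC⟩ := (continuous_deriv_smoothStep ε y).bounded_above_of_compact_support hc
  exact hv.mul_bdd (continuous_deriv_smoothStep ε y).aestronglyMeasurable
    (Eventually.of_forall hC)

/-- The derivative of the step is nonnegative, has mass one and lives in `[y + ε, y + 2ε]`: a
mollifier looking only to the right of `y`, for which right continuity suffices. -/
lemma tendsto_integral_mul_deriv_smoothStep {a b : ℝ} {v : ℝ → ℝ}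
    (hv : IntegrableOn v (Ioo a b)) {y : ℝ} (hy : y ∈ Ico a b)
    (hc : ContinuousWithinAt v (Ici y) y) :
    Tendsto (fun ε => ∫ x in Ioo a b, v x * deriv (smoothStep ε y) x) (𝓝[>] 0) (𝓝 (v y)) := by
  have hab : a < b := hy.1.trans_lt hy.2
  rw [Metric.tendsto_nhds]
  intro η hη
  have h1 : ∀ᶠ x in 𝓝[≥] y, dist (v x) (v y) < η / 2 :=
    Metric.tendsto_nhds.1 hc (η / 2) (by linarith)
  obtain ⟨z, hz, hz'⟩ := (mem_nhdsGE_iff_exists_Ico_subset' (show y < y + 1 by linarith)).1 h1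
  have hz0 : 0 < z - y := sub_pos.2 hz
  have hb0 : 0 < b - y := sub_pos.2 hy.2
  have hm : 0 < min ((z - y) / 3) ((b - y) / 3) := by positivity
  filter_upwards [Ioo_mem_nhdsGT hm] with ε hε
  have hε0 : 0 < ε := hε.1
  have hε1 : ε < (z - y) / 3 := hε.2.trans_le (min_le_left _ _)
  have hε2 : ε < (b - y) / 3 := hε.2.trans_le (min_le_right _ _)
  have hθ : IntegrableOn (deriv (smoothStep ε y)) (Ioo a b) :=
    ((continuous_deriv_smoothStep ε y).integrableOn_Icc).mono_set Ioo_subset_Icc_self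
  have hint : ∫ x in Ioo a b, deriv (smoothStep ε y) x = 1 := by
    rw [← integral_Ioc_eq_integral_Ioo, ← intervalIntegral.integral_of_le hab.le,
      intervalIntegral.integral_deriv_eq_sub
      (fun x _ => (contDiff_smoothStep ε y).differentiable (by simp) x)
      ((continuous_deriv_smoothStep ε y).intervalIntegrable _ _),
      smoothStep_eq_one hε0 (by linarith), smoothStep_eq_zero hε0 (by linarith [hy.1]), sub_zero]
  have h2 : (∫ x in Ioo a b, v x * deriv (smoothStep ε y) x) - v y
      = ∫ x in Ioo a b, (v x - v y) * deriv (smoothStep ε y) x := by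
    simp_rw [sub_mul]
    rw [integral_sub (integrableOn_mul_deriv_smoothStep hε0 hv y) (hθ.const_mul _),
      integral_const_mul, hint, mul_one]
  rw [Real.dist_eq, h2, ← Real.norm_eq_abs]
  refine lt_of_le_of_lt (norm_integral_le_of_norm_le (hθ.const_mul (η / 2))
    (Eventually.of_forall fun x => ?_)) ?_
  · by_cases hx : x ∈ Icc (y + ε) (y + 2 * ε)
    · have h3 : |v x - v y| < η / 2 := hz' ⟨by linarith [hx.1], by linarith [hx.2]⟩
      rw [Real.norm_eq_abs, abs_mul, abs_of_nonneg (monotone_smoothStep hε0 y).deriv_nonneg]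
      gcongr
      exact (monotone_smoothStep hε0 y).deriv_nonneg
    · simp [deriv_smoothStep_eq_zero hε0 hx]
  · rw [integral_const_mul, hint]; linarith

/-- The test function is a smoothed step function with value `s i` between `y i` and `y (i + 1)`.
Differences of consecutive steps are nonnegative and telescope, which bounds it by one. The steps
start `ε` to the right of the nodes, so `y 0 = a` is allowed. -/
lemma ofReal_sum_le_totalVariation {a b : ℝ} {v : ℝ → ℝ} (hv : IntegrableOn v (Ioo a b))
    {n : ℕ} {y : ℕ → ℝ} (hy : Monotone y) (hya : a ≤ y 0) {s : ℕ → ℝ} (hs : ∀ i, |s i| ≤ 1)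
    {ε : ℝ} (hε : 0 < ε) (hyb : y n + 2 * ε < b) :
    ENNReal.ofReal (∑ i ∈ Finset.range n,
      s i * ((∫ x in Ioo a b, v x * deriv (smoothStep ε (y (i + 1))) x) -
        ∫ x in Ioo a b, v x * deriv (smoothStep ε (y i)) x)) ≤ totalVariation a b v := by
  set φ : ℝ → ℝ := fun x => ∑ i ∈ Finset.range n,
    s i * (smoothStep ε (y i) x - smoothStep ε (y (i + 1)) x) with hφ
  have hsm : ContDiff ℝ ∞ φ := by
    apply ContDiff.sum
    intro i _
    exact contDiff_const.mul ((contDiff_smoothStep _ _).sub (contDiff_smoothStep _ _))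
  have hzero : ∀ x, x ∉ Icc (y 0 + ε) (y n + 2 * ε) → φ x = 0 := by
    intro x hx
    apply Finset.sum_eq_zero
    intro i hi
    have hi' : i + 1 ≤ n := Finset.mem_range.1 hi
    rw [mem_Icc, not_and_or, not_le, not_le] at hx
    rcases hx with h | h
    · rw [smoothStep_eq_zero hε, smoothStep_eq_zero hε]
      · simp
      · linarith [hy (Nat.zero_le (i + 1))]
      · linarith [hy (Nat.zero_le i)]
    · rw [smoothStep_eq_one hε, smoothStep_eq_one hε]
      · simp
      · linarith [hy hi']
      · linarith [hy ((Nat.le_succ i).trans hi')]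
  have hsub : Function.support φ ⊆ Icc (y 0 + ε) (y n + 2 * ε) := fun x hx => by
    by_contra h
    exact hx (hzero x h)
  have htest : IsTestFunction (Ioo a b) φ :=
    ⟨hsm, HasCompactSupport.of_support_subset_isCompact isCompact_Icc hsub,
      (closure_minimal hsub isClosed_Icc).trans fun x hx =>
        ⟨by linarith [hx.1], by linarith [hx.2]⟩⟩
  have hbound : ∀ x, |φ x| ≤ 1 := by
    intro x
    have h1 : ∀ i, 0 ≤ smoothStep ε (y i) x - smoothStep ε (y (i + 1)) x := fun i =>
      sub_nonneg.2 (smoothStep_antitone_left hε x (hy (Nat.le_succ i)))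
    calc |φ x| ≤ ∑ i ∈ Finset.range n,
          |s i * (smoothStep ε (y i) x - smoothStep ε (y (i + 1)) x)| :=
          Finset.abs_sum_le_sum_abs _ _
      _ ≤ ∑ i ∈ Finset.range n, (smoothStep ε (y i) x - smoothStep ε (y (i + 1)) x) := by
          apply Finset.sum_le_sum
          intro i _
          rw [abs_mul, abs_of_nonneg (h1 i)]
          exact mul_le_of_le_one_left (h1 i) (hs i)
      _ = smoothStep ε (y 0) x - smoothStep ε (y n) x := Finset.sum_range_sub' _ _
      _ ≤ 1 := by
          have h2 : smoothStep ε (y 0) x ≤ 1 := Real.smoothTransition.le_one _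
          have h3 : 0 ≤ smoothStep ε (y n) x := Real.smoothTransition.nonneg _
          linarith
  have hderiv : ∀ x, deriv φ x = ∑ i ∈ Finset.range n,
      s i * (deriv (smoothStep ε (y i)) x - deriv (smoothStep ε (y (i + 1))) x) := by
    intro x
    apply HasDerivAt.deriv
    apply HasDerivAt.fun_sum
    intro i _
    have h : ∀ z, HasDerivAt (smoothStep ε z) (deriv (smoothStep ε z) x) x := fun z =>
      ((contDiff_smoothStep ε z).differentiable (by simp) x).hasDerivAt
    exact ((h _).sub (h _)).const_mul _
  have hI := integrableOn_mul_deriv_smoothStep hε hv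
  have heq : -∫ x in Ioo a b, v x * deriv φ x = ∑ i ∈ Finset.range n,
      s i * ((∫ x in Ioo a b, v x * deriv (smoothStep ε (y (i + 1))) x) -
        ∫ x in Ioo a b, v x * deriv (smoothStep ε (y i)) x) := by
    rw [← integral_neg]
    have h1 : ∀ x, -(v x * deriv φ x) = ∑ i ∈ Finset.range n,
        s i * (v x * deriv (smoothStep ε (y (i + 1))) x - v x * deriv (smoothStep ε (y i)) x) := by
      intro x
      rw [hderiv, Finset.mul_sum, ← Finset.sum_neg_distrib]
      exact Finset.sum_congr rfl fun i _ => by ring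
    simp_rw [h1]
    rw [integral_finsetSum]
    · refine Finset.sum_congr rfl fun i _ => ?_
      rw [integral_const_mul, integral_sub (hI _) (hI _)]
    · exact fun i _ => ((hI _).sub (hI _)).const_mul _
  rw [← heq]
  exact le_iSup₂_of_le φ ⟨htest, hbound⟩ le_rfl

/-- The pointwise variation of a good representative is at most the total variation. -/
lemma eVariationOn_le_totalVariation {a b : ℝ} {v : ℝ → ℝ}
    (hv : IntegrableOn v (Ioo a b)) (hr : ∀ y ∈ Ico a b, ContinuousWithinAt v (Ici y) y)
    (hl : ContinuousWithinAt v (Iic b) b) :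
    eVariationOn v (Icc a b) ≤ totalVariation a b v := by
  -- Left continuity at `b` removes `b` from the partitions. All partition points then have room on
  -- their right for the steps.
  rw [← eVariationOn.eVariationOn_Ico_eq_Icc_of_continuousWithinAt hl]
  apply iSup_le
  rintro ⟨n, y, hy, hys⟩
  -- The signs turn the signed increments of the duality pairing into absolute values.
  set s : ℕ → ℝ := fun i => (SignType.sign (v (y (i + 1)) - v (y i)) : ℝ) with hs
  have hs1 : ∀ i, |s i| ≤ 1 := fun i => by
    simp only [hs]
    rcases lt_trichotomy (v (y (i + 1)) - v (y i)) 0 with h | h | h <;> simp [h]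
  have hlim : Tendsto (fun ε => ENNReal.ofReal (∑ i ∈ Finset.range n,
      s i * ((∫ x in Ioo a b, v x * deriv (smoothStep ε (y (i + 1))) x) -
        ∫ x in Ioo a b, v x * deriv (smoothStep ε (y i)) x))) (𝓝[>] 0)
      (𝓝 (ENNReal.ofReal (∑ i ∈ Finset.range n, s i * (v (y (i + 1)) - v (y i))))) := by
    apply ENNReal.tendsto_ofReal
    apply tendsto_finsetSum
    intro i _
    exact ((tendsto_integral_mul_deriv_smoothStep hv (hys _) (hr _ (hys _))).sub
      (tendsto_integral_mul_deriv_smoothStep hv (hys _) (hr _ (hys _)))).const_mul _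
  have hsum : ∑ i ∈ Finset.range n, edist (v (y (i + 1))) (v (y i)) =
      ENNReal.ofReal (∑ i ∈ Finset.range n, s i * (v (y (i + 1)) - v (y i))) := by
    rw [ENNReal.ofReal_sum_of_nonneg]
    · refine Finset.sum_congr rfl fun i _ => ?_
      rw [hs, sign_mul_self, edist_dist, Real.dist_eq]
    · intro i _
      rw [hs, sign_mul_self]; positivity
  simp only
  rw [hsum]
  refine le_of_tendsto hlim ?_
  have hn : 0 < (b - y n) / 2 := by linarith [(hys n).2]
  filter_upwards [Ioo_mem_nhdsGT hn] with ε hε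
  exact ofReal_sum_le_totalVariation hv hy (hys 0).1 hs1 hε.1 (by linarith [hε.2])

lemma totalVariation_congr_ae {a b : ℝ} {v w : ℝ → ℝ} (h : v =ᵐ[volume.restrict (Ioo a b)] w) :
    totalVariation a b v = totalVariation a b w := by
  refine iSup_congr fun φ => iSup_congr fun _ => ?_
  congr 2
  apply integral_congr_ae
  filter_upwards [h] with x hx
  rw [hx]

/-- Riemann sum estimate for the duality pairing defining the total variation. -/
lemma neg_integral_mul_deriv_le {a b : ℝ} (hab : a < b) {v φ : ℝ → ℝ}
    (hv : IntegrableOn v (Ioo a b)) (hvar : eVariationOn v (Icc a b) ≠ ⊤)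
    (hφ : IsTestFunction (Ioo a b) φ) (hφ1 : ∀ x, |φ x| ≤ 1) {C : ℝ}
    (hC : ∀ x, |deriv φ x| ≤ C) (n : ℕ) :
    -∫ x in Ioo a b, v x * deriv φ x ≤ (eVariationOn v (Icc a b)).toReal +
      C * ((b - a) / (n + 1)) * (eVariationOn v (Icc a b)).toReal := by
  set δ : ℝ := (b - a) / (n + 1) with hδ
  have hδ0 : 0 < δ := div_pos (by linarith) (by positivity)
  set x : ℕ → ℝ := fun i => a + i * δ with hx
  have hx0 : x 0 = a := by simp [hx]
  have hxn : x (n + 1) = b := by simp only [hx, hδ]; push_cast; field_simp; ring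
  have hxs : ∀ i, x (i + 1) = x i + δ := fun i => by simp only [hx]; push_cast; ring
  have hxm : Monotone x := monotone_nat_of_le_succ fun i => by rw [hxs]; linarith
  set V : ℕ → ℝ := fun i => (eVariationOn v (Icc (x i) (x (i + 1)))).toReal with hV
  have hC0 : 0 ≤ C := (abs_nonneg _).trans (hC a)
  have hsub : ∀ i ∈ Finset.range (n + 1), Icc (x i) (x (i + 1)) ⊆ Icc a b := fun i hi =>
    Icc_subset_Icc (hx0 ▸ hxm (Nat.zero_le i)) (hxn ▸ hxm (Finset.mem_range.1 hi))
  have hfin : ∀ i ∈ Finset.range (n + 1), eVariationOn v (Icc (x i) (x (i + 1))) ≠ ⊤ :=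
    fun i hi => ne_top_of_le_ne_top hvar (eVariationOn.mono v (hsub i hi))
  have hVsum : ∑ i ∈ Finset.range (n + 1), V i = (eVariationOn v (Icc a b)).toReal := by
    rw [← ENNReal.toReal_sum hfin, eVariationOn.sum' v hxm, hx0, hxn]
  have hdist : ∀ i ∈ Finset.range (n + 1), ∀ z ∈ Icc (x i) (x (i + 1)), |v z - v (x i)| ≤ V i := by
    intro i hi z hz
    have h1 := eVariationOn.edist_le v hz (left_mem_Icc.2 (hxm (Nat.le_succ i)))
    have h2 := ENNReal.toReal_mono (hfin i hi) h1
    rwa [edist_dist, ENNReal.toReal_ofReal dist_nonneg, Real.dist_eq] at h2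
  have hvI : IntervalIntegrable v volume a b := by
    rw [intervalIntegrable_iff_integrableOn_Ioo_of_le hab.le]; exact hv
  have hvφ : IntervalIntegrable (fun z => v z * deriv φ z) volume a b := by
    rw [intervalIntegrable_iff_integrableOn_Ioo_of_le hab.le]
    exact hφ.integrable_mul_deriv hv
  have hsubI : ∀ i ∈ Finset.range (n + 1), uIcc (x i) (x (i + 1)) ⊆ uIcc a b := fun i hi => by
    rw [uIcc_of_le (hxm (Nat.le_succ i)), uIcc_of_le hab.le]
    exact hsub i hi
  -- Freezing `v` at the left node of a cell costs at most `C δ` times the variation on the cell;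
  -- these errors sum to the remainder term.
  have hstep : ∀ i ∈ Finset.range (n + 1),
      -(∫ z in x i..x (i + 1), v z * deriv φ z) ≤
        -(v (x i) * (φ (x (i + 1)) - φ (x i))) + C * δ * V i := by
    intro i hi
    have h1 : ∫ z in x i..x (i + 1), deriv φ z = φ (x (i + 1)) - φ (x i) :=
      intervalIntegral.integral_deriv_eq_sub (fun z _ => hφ.differentiable z)
        (hφ.continuous_deriv.intervalIntegrable _ _)
    have h2 : ∫ z in x i..x (i + 1), (v z - v (x i)) * deriv φ z
        = (∫ z in x i..x (i + 1), v z * deriv φ z) - v (x i) * (φ (x (i + 1)) - φ (x i)) := by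
      simp_rw [sub_mul]
      rw [intervalIntegral.integral_sub (hvφ.mono_set (hsubI i hi))
        ((hφ.continuous_deriv.intervalIntegrable _ _).const_mul _),
        intervalIntegral.integral_const_mul, h1]
    have h3 : ‖∫ z in x i..x (i + 1), (v z - v (x i)) * deriv φ z‖ ≤
        V i * C * |x (i + 1) - x i| := by
      apply intervalIntegral.norm_integral_le_of_norm_le_const
      intro z hz
      rw [uIoc_of_le (hxm (Nat.le_succ i))] at hz
      rw [norm_mul]
      exact mul_le_mul (hdist i hi z (Ioc_subset_Icc_self hz)) (hC z) (norm_nonneg _)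
        ENNReal.toReal_nonneg
    rw [hxs i, add_sub_cancel_left, abs_of_pos hδ0, ← hxs i, h2, Real.norm_eq_abs, abs_le] at h3
    linarith [h3.1]
  -- Summation by parts; the boundary terms vanish since `φ` is zero at `a` and `b`.
  have hparts : ∑ i ∈ Finset.range (n + 1), -(v (x i) * (φ (x (i + 1)) - φ (x i))) =
      ∑ i ∈ Finset.range (n + 1), φ (x (i + 1)) * (v (x (i + 1)) - v (x i)) := by
    rw [← sub_eq_zero, ← Finset.sum_sub_distrib]
    have h1 : ∀ i, -(v (x i) * (φ (x (i + 1)) - φ (x i))) -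
        φ (x (i + 1)) * (v (x (i + 1)) - v (x i)) =
        φ (x i) * v (x i) - φ (x (i + 1)) * v (x (i + 1)) := fun i => by ring
    simp_rw [h1]
    rw [Finset.sum_range_sub' (fun i => φ (x i) * v (x i)), hx0, hxn,
      hφ.eq_zero (x := a) (by simp), hφ.eq_zero (x := b) (by simp)]
    simp
  have htot : ∫ z in Ioo a b, v z * deriv φ z
      = ∑ i ∈ Finset.range (n + 1), ∫ z in x i..x (i + 1), v z * deriv φ z := by
    rw [intervalIntegral.sum_integral_adjacent_intervals, hx0, hxn,
      intervalIntegral.integral_of_le hab.le, integral_Ioc_eq_integral_Ioo]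
    exact fun i hi => hvφ.mono_set (hsubI i (Finset.mem_range.2 hi))
  rw [htot, ← Finset.sum_neg_distrib]
  refine (Finset.sum_le_sum hstep).trans ?_
  rw [Finset.sum_add_distrib, hparts, ← Finset.mul_sum, hVsum]
  gcongr
  rw [← hVsum]
  apply Finset.sum_le_sum
  intro i hi
  calc φ (x (i + 1)) * (v (x (i + 1)) - v (x i))
      ≤ |φ (x (i + 1))| * |v (x (i + 1)) - v (x i)| := by rw [← abs_mul]; exact le_abs_self _
    _ ≤ 1 * V i := mul_le_mul (hφ1 _) (hdist i hi _ (right_mem_Icc.2 (hxm (Nat.le_succ i))))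
        (abs_nonneg _) zero_le_one
    _ = V i := one_mul _

/-- The total variation is at most the pointwise variation. -/
lemma totalVariation_le_eVariationOn {a b : ℝ} (hab : a < b) {v : ℝ → ℝ}
    (hv : IntegrableOn v (Ioo a b)) : totalVariation a b v ≤ eVariationOn v (Icc a b) := by
  by_cases hvar : eVariationOn v (Icc a b) = ⊤
  · simp [hvar]
  refine iSup₂_le fun φ ⟨hφ, hφ1⟩ => ?_
  obtain ⟨C, hC⟩ := hφ.exists_deriv_bound
  rw [← ENNReal.ofReal_toReal hvar]
  apply ENNReal.ofReal_le_ofReal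
  have hlim : Tendsto (fun n : ℕ => (eVariationOn v (Icc a b)).toReal +
      C * ((b - a) / ((n : ℝ) + 1)) * (eVariationOn v (Icc a b)).toReal) atTop
      (𝓝 ((eVariationOn v (Icc a b)).toReal + C * 0 * (eVariationOn v (Icc a b)).toReal)) := by
    refine tendsto_const_nhds.add (Tendsto.mul_const _ (Tendsto.const_mul _ ?_))
    exact tendsto_const_nhds.div_atTop
      (tendsto_atTop_add_const_right _ _ tendsto_natCast_atTop_atTop)
  rw [mul_zero, zero_mul, add_zero] at hlim
  exact ge_of_tendsto' hlim fun n => neg_integral_mul_deriv_le hab hv hvar hφ hφ1 hC n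

/-! ### Midpoint convexity and the squared norm -/

lemma totalVariation_midpoint_le {a b : ℝ} {v w : ℝ → ℝ} (hv : IntegrableOn v (Ioo a b))
    (hw : IntegrableOn w (Ioo a b)) (hvt : totalVariation a b v ≠ ⊤)
    (hwt : totalVariation a b w ≠ ⊤) :
    totalVariation a b (fun x => (v x + w x) / 2) ≤
      ENNReal.ofReal (((totalVariation a b v).toReal + (totalVariation a b w).toReal) / 2) := by
  refine iSup₂_le fun φ ⟨hφ, hφ1⟩ => ENNReal.ofReal_le_ofReal ?_
  have key : ∀ z : ℝ → ℝ, totalVariation a b z ≠ ⊤ →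
      -∫ x in Ioo a b, z x * deriv φ x ≤ (totalVariation a b z).toReal := fun z hz => by
    rw [← ENNReal.ofReal_le_iff_le_toReal hz]
    exact le_iSup₂_of_le φ ⟨hφ, hφ1⟩ le_rfl
  have h1 : ∫ x in Ioo a b, (v x + w x) / 2 * deriv φ x =
      ((∫ x in Ioo a b, v x * deriv φ x) + ∫ x in Ioo a b, w x * deriv φ x) / 2 := by
    rw [← integral_add (hφ.integrable_mul_deriv hv) (hφ.integrable_mul_deriv hw),
      ← integral_div]
    exact integral_congr_ae (Eventually.of_forall fun x => by ring)
  rw [h1]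
  linarith [key v hvt, key w hwt]

lemma eLpNorm_two_sq_eq_ofReal {μ : Measure ℝ} {f : ℝ → ℝ} (hf : MemLp f 2 μ) :
    eLpNorm f 2 μ ^ 2 = ENNReal.ofReal (∫ x, f x ^ 2 ∂μ) := by
  have h := eLpNorm_nnreal_pow_eq_lintegral (μ := μ) (f := f) (p := 2) (by norm_num)
  simp only [NNReal.coe_ofNat, ENNReal.coe_ofNat, ENNReal.rpow_ofNat] at h
  rw [h, ofReal_integral_eq_lintegral_ofReal hf.integrable_sq
    (Eventually.of_forall fun x => sq_nonneg _)]
  refine lintegral_congr fun x => ?_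
  rw [← ofReal_norm, ← ENNReal.ofReal_pow (norm_nonneg _), Real.norm_eq_abs, sq_abs]

/-! ### One-sided traces -/

section Average

variable {v w z : ℝ → ℝ} {I : ℝ → Set ℝ} {t : ℝ}

lemma setAverage_eq_inv_mul {f : ℝ → ℝ} {A : Set ℝ} {r : ℝ} (hr : volume.real A = r) :
    ⨍ y in A, f y = r⁻¹ * ∫ y in A, f y := by
  rw [setAverage_eq, hr, smul_eq_mul]

lemma tendsto_setAverage_of_ae_le (hI : ∀ r, 0 < r → volume.real (I r) = r)
    (hfin : ∀ r, volume (I r) ≠ ⊤)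
    (h : ∀ η > 0, ∀ᶠ r in 𝓝[>] (0 : ℝ), ∀ᵐ y ∂volume, y ∈ I r → |v y - t| ≤ η) :
    Tendsto (fun r => ⨍ y in I r, |v y - t|) (𝓝[>] 0) (𝓝 0) := by
  rw [Metric.tendsto_nhds]
  intro η hη
  filter_upwards [h (η / 2) (by linarith), self_mem_nhdsWithin] with r hr (hr0 : 0 < r)
  have h1 := norm_setIntegral_le_of_norm_le_const_ae' (f := fun y => |v y - t|)
    (hfin r).lt_top (C := η / 2) (by simpa using hr)
  rw [hI r hr0] at h1
  rw [dist_zero_right, setAverage_eq_inv_mul (hI r hr0), norm_mul, norm_inv,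
    Real.norm_of_nonneg hr0.le]
  calc r⁻¹ * ‖∫ y in I r, |v y - t|‖ ≤ r⁻¹ * (η / 2 * r) := by gcongr
    _ = η / 2 := by field_simp
    _ < η := by linarith

/-- The family `I r` stands for either one-sided neighbourhood. With `z` a midpoint or a truncation
this preserves zero traces; with `z` constant it gives uniqueness of traces. -/
lemma tendsto_setAverage_zero_of_le (hI : ∀ r, 0 < r → volume.real (I r) = r)
    (hv : ∀ᶠ r in 𝓝[>] (0 : ℝ), IntegrableOn v (I r))
    (hw : ∀ᶠ r in 𝓝[>] (0 : ℝ), IntegrableOn w (I r)) {s : ℝ}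
    (hle : ∀ y, |z y| ≤ |v y - t| + |w y - s|) (hfin : ∀ r, volume (I r) ≠ ⊤)
    (htv : Tendsto (fun r => ⨍ y in I r, |v y - t|) (𝓝[>] 0) (𝓝 0))
    (htw : Tendsto (fun r => ⨍ y in I r, |w y - s|) (𝓝[>] 0) (𝓝 0)) :
    Tendsto (fun r => ⨍ y in I r, |z y|) (𝓝[>] 0) (𝓝 0) := by
  have h0 := htv.add htw
  rw [add_zero] at h0
  refine tendsto_of_tendsto_of_tendsto_of_le_of_le' tendsto_const_nhds h0 ?_ ?_
  · filter_upwards [self_mem_nhdsWithin] with r (hr : 0 < r)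
    rw [setAverage_eq_inv_mul (hI r hr)]
    exact mul_nonneg (inv_nonneg.2 hr.le) (integral_nonneg fun _ => abs_nonneg _)
  · filter_upwards [hv, hw, self_mem_nhdsWithin] with r hr1 hr2 (hr : 0 < r)
    have hc : ∀ c : ℝ, IntegrableOn (fun _ => c) (I r) := fun c => integrableOn_const (hfin r)
    have h1 : IntegrableOn (fun y => |v y - t|) (I r) := (hr1.sub (hc t)).abs
    have h2 : IntegrableOn (fun y => |w y - s|) (I r) := (hr2.sub (hc s)).abs
    rw [setAverage_eq_inv_mul (hI r hr), setAverage_eq_inv_mul (hI r hr),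
      setAverage_eq_inv_mul (hI r hr), ← mul_add, ← integral_add h1 h2]
    refine mul_le_mul_of_nonneg_left (integral_mono_of_nonneg
      (Eventually.of_forall fun _ => abs_nonneg _) (h1.add h2)
      (Eventually.of_forall hle)) (inv_nonneg.2 hr.le)

end Average

lemma volume_real_Ioo_right (x r : ℝ) (hr : 0 < r) : volume.real (Ioo x (x + r)) = r := by
  rw [Real.volume_real_Ioo_of_le (by linarith)]; ring

lemma volume_real_Ioo_left (x r : ℝ) (hr : 0 < r) : volume.real (Ioo (x - r) x) = r := by
  rw [Real.volume_real_Ioo_of_le (by linarith)]; ring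

lemma eventually_integrableOn_right {a b : ℝ} (hab : a < b) {v : ℝ → ℝ}
    (hv : IntegrableOn v (Ioo a b)) : ∀ᶠ r in 𝓝[>] (0 : ℝ), IntegrableOn v (Ioo a (a + r)) := by
  filter_upwards [Ioo_mem_nhdsGT (sub_pos.2 hab)] with r hr
  exact hv.mono_set (Ioo_subset_Ioo_right (by linarith [hr.2]))

lemma eventually_integrableOn_left {a b : ℝ} (hab : a < b) {v : ℝ → ℝ}
    (hv : IntegrableOn v (Ioo a b)) : ∀ᶠ r in 𝓝[>] (0 : ℝ), IntegrableOn v (Ioo (b - r) b) := by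
  filter_upwards [Ioo_mem_nhdsGT (sub_pos.2 hab)] with r hr
  exact hv.mono_set (Ioo_subset_Ioo_left (by linarith [hr.2]))

lemma hasRightTrace_zero_of_le {a b : ℝ} (hab : a < b) {v w z : ℝ → ℝ}
    (hv : IntegrableOn v (Ioo a b)) (hw : IntegrableOn w (Ioo a b))
    (hle : ∀ y, |z y| ≤ |v y| + |w y|) (hv0 : HasRightTrace v a 0) (hw0 : HasRightTrace w a 0) :
    HasRightTrace z a 0 := by
  simpa [HasRightTrace] using tendsto_setAverage_zero_of_le (volume_real_Ioo_right a)
    (eventually_integrableOn_right hab hv) (eventually_integrableOn_right hab hw)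
    (by simpa using hle) (by simp) hv0 hw0

lemma hasLeftTrace_zero_of_le {a b : ℝ} (hab : a < b) {v w z : ℝ → ℝ}
    (hv : IntegrableOn v (Ioo a b)) (hw : IntegrableOn w (Ioo a b))
    (hle : ∀ y, |z y| ≤ |v y| + |w y|) (hv0 : HasLeftTrace v b 0) (hw0 : HasLeftTrace w b 0) :
    HasLeftTrace z b 0 := by
  simpa [HasLeftTrace] using tendsto_setAverage_zero_of_le (volume_real_Ioo_left b)
    (eventually_integrableOn_left hab hv) (eventually_integrableOn_left hab hw)
    (by simpa using hle) (by simp) hv0 hw0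

lemma eq_zero_of_tendsto_setAverage_const {I : ℝ → Set ℝ} {c : ℝ}
    (hI : ∀ r, 0 < r → volume.real (I r) = r)
    (h : Tendsto (fun r => ⨍ _ in I r, |c|) (𝓝[>] 0) (𝓝 0)) : c = 0 := by
  have h1 : Tendsto (fun _ : ℝ => |c|) (𝓝[>] 0) (𝓝 0) := by
    refine h.congr' ?_
    filter_upwards [self_mem_nhdsWithin] with r (hr : 0 < r)
    rw [setAverage_eq_inv_mul (hI r hr), setIntegral_const, hI r hr, smul_eq_mul]
    field_simp
  exact abs_eq_zero.1 (tendsto_nhds_unique tendsto_const_nhds h1)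

lemma HasRightTrace.unique {a b : ℝ} (hab : a < b) {v : ℝ → ℝ} (hv : IntegrableOn v (Ioo a b))
    {s t : ℝ} (hs : HasRightTrace v a s) (ht : HasRightTrace v a t) : s = t := by
  refine sub_eq_zero.1 (eq_zero_of_tendsto_setAverage_const (volume_real_Ioo_right a) ?_)
  refine tendsto_setAverage_zero_of_le (z := fun _ => s - t) (volume_real_Ioo_right a)
    (eventually_integrableOn_right hab hv) (eventually_integrableOn_right hab hv)
    (fun y => ?_) (by simp) ht hs
  rw [abs_sub_comm (v y) s, add_comm]; exact abs_sub_le _ _ _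

lemma HasLeftTrace.unique {a b : ℝ} (hab : a < b) {v : ℝ → ℝ} (hv : IntegrableOn v (Ioo a b))
    {s t : ℝ} (hs : HasLeftTrace v b s) (ht : HasLeftTrace v b t) : s = t := by
  refine sub_eq_zero.1 (eq_zero_of_tendsto_setAverage_const (volume_real_Ioo_left b) ?_)
  refine tendsto_setAverage_zero_of_le (z := fun _ => s - t) (volume_real_Ioo_left b)
    (eventually_integrableOn_left hab hv) (eventually_integrableOn_left hab hv)
    (fun y => ?_) (by simp) ht hs
  rw [abs_sub_comm (v y) s, add_comm]; exact abs_sub_le _ _ _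

lemma hasRightTrace_of_ae_eq {p q : ℝ} (hpq : p < q) {u f : ℝ → ℝ}
    (h : u =ᵐ[volume.restrict (Ioo p q)] f) (hf : ContinuousWithinAt f (Icc p q) p) :
    HasRightTrace u p (f p) := by
  refine tendsto_setAverage_of_ae_le (volume_real_Ioo_right p) (by simp) fun η hη => ?_
  obtain ⟨δ, hδ, hδ'⟩ := Metric.continuousWithinAt_iff.1 hf η hη
  rw [EventuallyEq, ae_restrict_iff' measurableSet_Ioo] at h
  filter_upwards [Ioo_mem_nhdsGT (lt_min hδ (sub_pos.2 hpq))] with r hr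
  have h1 := hr.2.trans_le (min_le_left _ _)
  have h2 := hr.2.trans_le (min_le_right _ _)
  filter_upwards [h] with y hy hy'
  rw [hy ⟨hy'.1, by linarith [hy'.2]⟩]
  refine (hδ' ⟨hy'.1.le, by linarith [hy'.2]⟩ ?_).le
  rw [Real.dist_eq, abs_of_pos (by linarith [hy'.1])]
  linarith [hy'.2]

lemma hasLeftTrace_of_ae_eq {p q : ℝ} (hpq : p < q) {u f : ℝ → ℝ}
    (h : u =ᵐ[volume.restrict (Ioo p q)] f) (hf : ContinuousWithinAt f (Icc p q) q) :
    HasLeftTrace u q (f q) := by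
  refine tendsto_setAverage_of_ae_le (volume_real_Ioo_left q) (by simp) fun η hη => ?_
  obtain ⟨δ, hδ, hδ'⟩ := Metric.continuousWithinAt_iff.1 hf η hη
  rw [EventuallyEq, ae_restrict_iff' measurableSet_Ioo] at h
  filter_upwards [Ioo_mem_nhdsGT (lt_min hδ (sub_pos.2 hpq))] with r hr
  have h1 := hr.2.trans_le (min_le_left _ _)
  have h2 := hr.2.trans_le (min_le_right _ _)
  filter_upwards [h] with y hy hy'
  rw [hy ⟨by linarith [hy'.1], hy'.2⟩]
  refine (hδ' ⟨by linarith [hy'.1], hy'.2.le⟩ ?_).le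
  rw [Real.dist_eq, abs_of_neg (by linarith [hy'.2])]
  linarith [hy'.1]

/-! ### The real-valued energy and strong convexity -/

/-- The Rudin-Osher-Fatemi functional as a real number. -/
def realEnergy (a b α : ℝ) (g v : ℝ → ℝ) : ℝ :=
  (totalVariation a b v).toReal + α / 2 * ∫ x in Ioo a b, (g x - v x) ^ 2

lemma energy_eq_ofReal {a b α : ℝ} (hα : 0 < α) {g v : ℝ → ℝ}
    (hg : MemLp g 2 (volume.restrict (Ioo a b))) (hv : MemLp v 2 (volume.restrict (Ioo a b)))
    (ht : totalVariation a b v ≠ ⊤) :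
    energy a b α g v = ENNReal.ofReal (realEnergy a b α g v) := by
  have h0 : 0 ≤ ∫ x in Ioo a b, (g x - v x) ^ 2 := integral_nonneg fun _ => sq_nonneg _
  unfold energy realEnergy
  rw [ENNReal.ofReal_add ENNReal.toReal_nonneg (by positivity), ENNReal.ofReal_toReal ht,
    ENNReal.ofReal_mul (by positivity),
    eLpNorm_two_sq_eq_ofReal (f := fun x => g x - v x) (hg.sub hv)]

lemma realEnergy_nonneg {a b α : ℝ} (hα : 0 < α) (g v : ℝ → ℝ) : 0 ≤ realEnergy a b α g v := by
  have h0 : 0 ≤ ∫ x in Ioo a b, (g x - v x) ^ 2 := integral_nonneg fun _ => sq_nonneg _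
  unfold realEnergy
  positivity

lemma midpoint_mem_admissible {a b : ℝ} (hab : a < b) {Γ : Set ℝ} {u w : ℝ → ℝ}
    (hu : u ∈ admissible a b Γ) (hw : w ∈ admissible a b Γ) :
    (fun x => (u x + w x) / 2) ∈ admissible a b Γ := by
  obtain ⟨⟨hu1, hut⟩, hu2, hua, hub⟩ := hu
  obtain ⟨⟨hw1, hwt⟩, hw2, hwa, hwb⟩ := hw
  have huI : IntegrableOn u (Ioo a b) := memLp_one_iff_integrable.1 hu1
  have hwI : IntegrableOn w (Ioo a b) := memLp_one_iff_integrable.1 hw1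
  have heq : (fun x => (u x + w x) / 2) = fun x => (1 / 2 : ℝ) * (u x + w x) := by
    funext x; ring
  have hle : ∀ y, |(u y + w y) / 2| ≤ |u y| + |w y| := fun y => by
    rw [abs_div, abs_two]
    linarith [abs_add_le (u y) (w y), abs_nonneg (u y), abs_nonneg (w y)]
  refine ⟨⟨?_, ?_⟩, ?_, fun h => hasRightTrace_zero_of_le hab huI hwI hle (hua h) (hwa h),
    fun h => hasLeftTrace_zero_of_le hab huI hwI hle (hub h) (hwb h)⟩
  · rw [heq]; exact (hu1.add hw1).const_mul _
  · exact (totalVariation_midpoint_le huI hwI hut.ne hwt.ne).trans_lt ENNReal.ofReal_lt_top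
  · rw [heq]; exact (hu2.add hw2).const_mul _

/-- Quantitative uniqueness of the minimizer, from the strong convexity of the functional. -/
lemma IsMinimizer.integral_sq_le {a b α : ℝ} (hab : a < b) (hα : 0 < α) {Γ : Set ℝ}
    {g u w : ℝ → ℝ} (hg : MemLp g 2 (volume.restrict (Ioo a b)))
    (hu : IsMinimizer a b α Γ g u) (hw : w ∈ admissible a b Γ) :
    α / 4 * ∫ x in Ioo a b, (u x - w x) ^ 2 ≤ realEnergy a b α g w - realEnergy a b α g u := by
  obtain ⟨hua, humin⟩ := hu
  have hz := midpoint_mem_admissible hab hua hw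
  have h1 := humin hz
  simp only [mem_ofPred_eq] at h1
  rw [energy_eq_ofReal hα hg hua.2.1 hua.1.2.ne, energy_eq_ofReal hα hg hz.2.1 hz.1.2.ne,
    ENNReal.ofReal_le_ofReal_iff (realEnergy_nonneg hα _ _)] at h1
  have huI : IntegrableOn u (Ioo a b) := memLp_one_iff_integrable.1 hua.1.1
  have hwI : IntegrableOn w (Ioo a b) := memLp_one_iff_integrable.1 hw.1.1
  have h2 := ENNReal.toReal_mono ENNReal.ofReal_ne_top
    (totalVariation_midpoint_le huI hwI hua.1.2.ne hw.1.2.ne)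
  rw [ENNReal.toReal_ofReal (by positivity)] at h2
  have hIu : Integrable (fun x => (g x - u x) ^ 2) (volume.restrict (Ioo a b)) :=
    (hg.sub hua.2.1).integrable_sq
  have hIw : Integrable (fun x => (g x - w x) ^ 2) (volume.restrict (Ioo a b)) :=
    (hg.sub hw.2.1).integrable_sq
  have hId : Integrable (fun x => (u x - w x) ^ 2) (volume.restrict (Ioo a b)) :=
    (hua.2.1.sub hw.2.1).integrable_sq
  -- The parallelogram identity. With convexity of the total variation, `I(u) ≤ I((u + w)/2) ≤ (I(u)
  -- + I(w))/2 - (α/8) ‖u - w‖²`; doubling gives the factor `α/4`.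
  have h3 : ∫ x in Ioo a b, (g x - (u x + w x) / 2) ^ 2 =
      ((∫ x in Ioo a b, (g x - u x) ^ 2) + ∫ x in Ioo a b, (g x - w x) ^ 2) / 2 -
        (∫ x in Ioo a b, (u x - w x) ^ 2) / 4 := by
    have hIs : Integrable (fun x => ((g x - u x) ^ 2 + (g x - w x) ^ 2) / 2)
      (volume.restrict (Ioo a b)) := (hIu.add hIw).div_const 2
    rw [← integral_add hIu hIw, ← integral_div, ← integral_div,
      ← integral_sub hIs (hId.div_const 4)]
    exact integral_congr_ae (Eventually.of_forall fun x => by ring)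
  unfold realEnergy at h1 ⊢
  rw [h3] at h1
  linear_combination 2 * h1 + 2 * h2

/-! ### Vertices and element lengths of graded meshes -/

lemma exists_strictMono_enumeration (s : Finset ℝ) (hs : s.Nonempty) :
    ∃ (x : ℕ → ℝ) (n : ℕ), StrictMono x ∧ (s : Set ℝ) = x '' Iic n := by
  induction s using Finset.induction_on_max with
  | empty => exact absurd hs Finset.not_nonempty_empty
  | insert c s hc ih =>
    rcases s.eq_empty_or_nonempty with rfl | hne
    · refine ⟨fun k => c + k, 0, fun i j h => by simpa using h, ?_⟩
      ext y
      simp [eq_comm]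
    obtain ⟨x, n, hx, hsx⟩ := ih hne
    have hlt : ∀ k ≤ n, x k < c := fun k hk =>
      hc _ (by rw [← Finset.mem_coe, hsx]; exact mem_image_of_mem _ hk)
    -- The new maximum `c` gets index `n + 1`. Beyond it unit steps keep the sequence strictly
    -- monotone on all of `ℕ`; those values are not vertices.
    refine ⟨fun k => if k ≤ n then x k else c + (k - (n + 1) : ℕ), n + 1, ?_, ?_⟩
    · refine strictMono_nat_of_lt_succ fun k => ?_
      rcases lt_trichotomy k n with h | rfl | h
      · rw [if_pos h.le, if_pos (Nat.succ_le_of_lt h)]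
        exact hx (Nat.lt_succ_self k)
      · rw [if_pos le_rfl, if_neg (by omega)]
        have h1 := hlt k le_rfl
        have h2 : (0 : ℝ) ≤ ((k + 1 - (k + 1) : ℕ) : ℝ) := Nat.cast_nonneg _
        linarith
      · rw [if_neg (by omega), if_neg (by omega)]
        have h2 : ((k - (n + 1) : ℕ) : ℝ) < ((k + 1 - (n + 1) : ℕ) : ℝ) := by
          exact_mod_cast (by omega)
        linarith
    · ext y
      simp only [Finset.coe_insert, mem_insert_iff, hsx, mem_image, mem_Iic]
      constructor
      · rintro (rfl | ⟨k, hk, rfl⟩)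
        · exact ⟨n + 1, le_rfl, by simp⟩
        · exact ⟨k, by omega, by simp [hk]⟩
      · rintro ⟨k, hk, rfl⟩
        by_cases hkn : k ≤ n
        · exact Or.inr ⟨k, hkn, by simp [hkn]⟩
        · obtain rfl : k = n + 1 := by omega
          exact Or.inl (by simp)

/-- Bernoulli's inequality for `(s/t)^β`, multiplied by `t^β`, together with `t^β ≤ t` on `[0,1]`.
-/
lemma rpow_sub_rpow_le {β s t : ℝ} (hβ : 1 ≤ β) (hs : 0 ≤ s) (hst : s ≤ t) (ht : t ≤ 1) :
    t ^ β - s ^ β ≤ β * (t - s) := by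
  rcases hs.eq_or_lt with rfl | hs0
  · rw [Real.zero_rpow (by linarith), sub_zero, sub_zero]
    rcases hst.eq_or_lt with rfl | ht0
    · rw [Real.zero_rpow (by linarith)]; simp
    · calc t ^ β ≤ t ^ (1 : ℝ) := Real.rpow_le_rpow_of_exponent_ge ht0 ht hβ
        _ = t := Real.rpow_one t
        _ ≤ β * t := le_mul_of_one_le_left ht0.le hβ
  · have ht0 : 0 < t := hs0.trans_le hst
    have h1 := one_add_mul_self_le_rpow_one_add (s := s / t - 1)
      (by linarith [div_pos hs0 ht0]) hβ
    rw [add_sub_cancel, Real.div_rpow hs ht0.le, le_div_iff₀ (by positivity)] at h1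
    have h2 : t ^ β ≤ t := by
      simpa using Real.rpow_le_rpow_of_exponent_ge ht0 ht hβ
    have h3 : t ^ β - s ^ β ≤ β * (1 - s / t) * t ^ β := by linarith
    refine h3.trans ?_
    have h4 : 0 ≤ β * (1 - s / t) := mul_nonneg (by linarith) (by
      rw [sub_nonneg, div_le_one ht0]; exact hst)
    calc β * (1 - s / t) * t ^ β ≤ β * (1 - s / t) * t := by gcongr
      _ = β * (t - s) := by field_simp

section Grid

variable {β : ℝ} {J : ℕ} {c d : ℝ}

lemma mem_gradedGrid {z : ℝ} :
    z ∈ gradedGrid β J c d ↔ ∃ j ≤ J, z = c + ((j : ℝ) / J) ^ β * (d - c) := by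
  constructor
  · rintro ⟨_, ⟨j, hj, rfl⟩, rfl⟩
    exact ⟨j, hj, by rw [AffineMap.lineMap_apply_ring']; ring⟩
  · rintro ⟨j, hj, rfl⟩
    exact ⟨_, ⟨j, hj, rfl⟩, by rw [AffineMap.lineMap_apply_ring']; ring⟩

lemma finite_gradedGrid : (gradedGrid β J c d).Finite := by
  apply ((Set.finite_Iic J).image fun j : ℕ => c + ((j : ℝ) / J) ^ β * (d - c)).subset
  intro z hz
  obtain ⟨j, hj, rfl⟩ := mem_gradedGrid.1 hz
  exact ⟨j, hj, rfl⟩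

lemma left_mem_gradedGrid (hβ : 1 ≤ β) : c ∈ gradedGrid β J c d :=
  mem_gradedGrid.2 ⟨0, Nat.zero_le _, by
    rw [Nat.cast_zero, zero_div, Real.zero_rpow (by linarith)]; ring⟩

lemma right_mem_gradedGrid (hJ : 1 ≤ J) : d ∈ gradedGrid β J c d :=
  mem_gradedGrid.2 ⟨J, le_rfl, by
    rw [div_self (by exact_mod_cast (by omega)), Real.one_rpow]; ring⟩

lemma div_rpow_mem_Icc (hβ : 1 ≤ β) (hJ : 1 ≤ J) {j : ℕ} (hj : j ≤ J) :
    ((j : ℝ) / J) ^ β ∈ Icc (0 : ℝ) 1 := by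
  have hJ0 : (0 : ℝ) < J := by exact_mod_cast hJ
  have h1 : (j : ℝ) / J ≤ 1 := by rw [div_le_one hJ0]; exact_mod_cast hj
  exact ⟨by positivity, Real.rpow_le_one (by positivity) h1 (by linarith)⟩

lemma gradedGrid_subset (hβ : 1 ≤ β) (hJ : 1 ≤ J) (hcd : c ≤ d) : gradedGrid β J c d ⊆ Icc c d := by
  intro z hz
  obtain ⟨j, hj, rfl⟩ := mem_gradedGrid.1 hz
  obtain ⟨h0, h1⟩ := div_rpow_mem_Icc hβ hJ hj
  constructor <;> nlinarith

lemma gradedGrid_subset' (hβ : 1 ≤ β) (hJ : 1 ≤ J) (hcd : c ≤ d) :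
    gradedGrid β J d c ⊆ Icc c d := by
  intro z hz
  obtain ⟨j, hj, rfl⟩ := mem_gradedGrid.1 hz
  obtain ⟨h0, h1⟩ := div_rpow_mem_Icc hβ hJ hj
  constructor <;> nlinarith

/-- The grid of a macro element `[c,d]` lies in it and contains its end points. -/
lemma macroGrid_bounds (hβ : 1 ≤ β) (hJ : 1 ≤ J) (hcd : c ≤ d) {A : Set ℝ} {p₁ p₂ p₃ : Prop}
    (hA : (A = gradedGrid β J c d ∧ p₁) ∨ (A = gradedGrid β J d c ∧ p₂) ∨
      (A = gradedGrid 1 J c d ∧ p₃)) : (c ∈ A ∧ d ∈ A) ∧ A ⊆ Icc c d := by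
  rcases hA with h | h | h <;> rw [h.1]
  · exact ⟨⟨left_mem_gradedGrid hβ, right_mem_gradedGrid hJ⟩, gradedGrid_subset hβ hJ hcd⟩
  · exact ⟨⟨right_mem_gradedGrid hJ, left_mem_gradedGrid hβ⟩, gradedGrid_subset' hβ hJ hcd⟩
  · exact ⟨⟨left_mem_gradedGrid le_rfl, right_mem_gradedGrid hJ⟩,
      gradedGrid_subset le_rfl hJ hcd⟩

lemma div_rpow_lt_succ_div_rpow (hβ : 1 ≤ β) (hJ : 1 ≤ J) (j : ℕ) :
    ((j : ℝ) / J) ^ β < (((j + 1 : ℕ) : ℝ) / J) ^ β := by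
  have hJ0 : (0 : ℝ) < J := by exact_mod_cast hJ
  refine Real.rpow_lt_rpow (by positivity) ?_ (by linarith)
  gcongr
  exact Nat.lt_succ_self j

lemma succ_div_rpow_sub_le (hβ : 1 ≤ β) (hJ : 1 ≤ J) {j : ℕ} (hj : j + 1 ≤ J) :
    (((j + 1 : ℕ) : ℝ) / J) ^ β - ((j : ℝ) / J) ^ β ≤ β * (1 / J) := by
  have hJ0 : (0 : ℝ) < J := by exact_mod_cast hJ
  have h1 : (((j + 1 : ℕ) : ℝ) / J) - (j : ℝ) / J = 1 / J := by push_cast; ring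
  have h := rpow_sub_rpow_le hβ (s := (j : ℝ) / J) (t := ((j + 1 : ℕ) : ℝ) / J) (by positivity)
    (by gcongr; exact Nat.le_succ j) (by rw [div_le_one hJ0]; exact_mod_cast hj)
  rwa [h1] at h

/-- Element lengths in a macro element `[c,d]` graded towards `c`. -/
lemma length_le_of_gradedGrid_left (hβ : 1 ≤ β) (hJ : 1 ≤ J) (hcd : c < d) {p q : ℝ}
    (hp : p ∈ gradedGrid β J c d) (hpd : p < d) (hq : ∀ z ∈ gradedGrid β J c d, p < z → q ≤ z) :
    q - p ≤ (d - c) * (β * (1 / J)) ∧ (p = c → q - p ≤ (d - c) * (1 / J) ^ β) := by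
  have hL : 0 < d - c := sub_pos.2 hcd
  constructor
  · obtain ⟨j, hj, rfl⟩ := mem_gradedGrid.1 hp
    have hjJ : j + 1 ≤ J := by
      by_contra h
      obtain rfl : j = J := by omega
      rw [div_self (by exact_mod_cast (by omega)), Real.one_rpow] at hpd
      linarith
    have h1 := hq _ (mem_gradedGrid.2 ⟨j + 1, hjJ, rfl⟩)
      (by have := div_rpow_lt_succ_div_rpow hβ hJ j; gcongr)
    have h2 := mul_le_mul_of_nonneg_right (succ_div_rpow_sub_le hβ hJ hjJ) hL.le
    linarith
  · rintro rfl
    have h0 := div_rpow_lt_succ_div_rpow hβ hJ 0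
    rw [zero_add, Nat.cast_one, Nat.cast_zero, zero_div, Real.zero_rpow (by linarith)] at h0
    have h1 := hq _ (mem_gradedGrid.2 ⟨1, hJ, rfl⟩) (by
      rw [Nat.cast_one]; linarith [mul_pos h0 hL])
    rw [Nat.cast_one] at h1
    linarith

/-- Element lengths in a macro element `[c,d]` graded towards `d`. -/
lemma length_le_of_gradedGrid_right (hβ : 1 ≤ β) (hJ : 1 ≤ J) (hcd : c < d) {p q : ℝ}
    (hp : p ∈ gradedGrid β J d c) (hpd : p < d) (hq : ∀ z ∈ gradedGrid β J d c, p < z → q ≤ z) :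
    q - p ≤ (d - c) * (β * (1 / J)) ∧ (q = d → q - p ≤ (d - c) * (1 / J) ^ β) := by
  have hL : 0 < d - c := sub_pos.2 hcd
  obtain ⟨j, hj, rfl⟩ := mem_gradedGrid.1 hp
  -- Indices run from `d` back to `c`: index `0` is `d` itself, and the right neighbour of index `i
  -- + 1` is index `i`.
  obtain ⟨i, rfl⟩ : ∃ i, j = i + 1 := by
    refine Nat.exists_eq_succ_of_ne_zero ?_
    rintro rfl
    rw [Nat.cast_zero, zero_div, Real.zero_rpow (by linarith)] at hpd
    linarith
  have h0 := div_rpow_lt_succ_div_rpow hβ hJ i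
  have h1 := hq _ (mem_gradedGrid.2 ⟨i, by omega, rfl⟩) (by nlinarith)
  have h2 := mul_le_mul_of_nonneg_right (succ_div_rpow_sub_le hβ hJ hj) hL.le
  refine ⟨by linarith, ?_⟩
  rintro rfl
  -- If `q = d`, the right neighbour must be `d`, so `i = 0` and the element is the smallest one.
  have h3 : ((i : ℝ) / J) ^ β ≤ 0 := by
    by_contra! h
    nlinarith
  have h4 : i = 0 := by
    by_contra h
    have hJ0 : (0 : ℝ) < J := by exact_mod_cast hJ
    have hi0 : (0 : ℝ) < i := by exact_mod_cast Nat.pos_of_ne_zero h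
    exact absurd h3 (not_le.2 (by positivity))
  subst h4
  rw [zero_add, Nat.cast_one]
  linarith

end Grid

/-- Take the largest index whose macro vertex is at most `p`. -/
lemma exists_macroElement {M : ℕ} {m : Fin (M + 1) → ℝ} {p : ℝ} (h0 : m 0 ≤ p)
    (h1 : p < m (Fin.last M)) : ∃ k : Fin M, m k.castSucc ≤ p ∧ p < m k.succ := by
  set A := Finset.univ.filter fun k => m k ≤ p with hA
  have hne : A.Nonempty := ⟨0, by simp [hA, h0]⟩
  have hmem : m (A.max' hne) ≤ p := by simpa [hA] using A.max'_mem hne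
  obtain ⟨k, hk⟩ : ∃ k : Fin M, k.castSucc = A.max' hne := by
    refine Fin.exists_castSucc_eq.2 fun h => ?_
    rw [h] at hmem
    linarith
  refine ⟨k, hk ▸ hmem, ?_⟩
  by_contra! h
  have h2 := A.le_max' k.succ (by simp [hA, h])
  rw [← hk] at h2
  exact absurd h2 (not_le.2 Fin.castSucc_lt_succ)

section Mesh

variable {a b β : ℝ} {J : ℕ} {S N : Set ℝ}

lemma IsGradedMesh.finite (h : IsGradedMesh a b β J S N) : N.Finite := by
  obtain ⟨M, m, G, hm, h0, h1, hS, hG, rfl⟩ := h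
  refine Set.finite_iUnion fun k => ?_
  rcases hG k with h | h | h <;> rw [h.1] <;> exact finite_gradedGrid

lemma IsGradedMesh.range_subset (hβ : 1 ≤ β) (hJ : 1 ≤ J) (hab : a < b)
    (h : IsGradedMesh a b β J S N) : a ∈ N ∧ b ∈ N ∧ S ⊆ N ∧ N ⊆ Icc a b := by
  obtain ⟨M, m, G, hm, rfl, rfl, hS, hG, rfl⟩ := h
  have hends : ∀ k, m k.castSucc ∈ G k ∧ m k.succ ∈ G k := fun k =>
    (macroGrid_bounds hβ hJ (hm Fin.castSucc_lt_succ).le (hG k)).1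
  obtain ⟨M, rfl⟩ : ∃ M', M = M' + 1 := by
    refine Nat.exists_eq_succ_of_ne_zero ?_
    rintro rfl
    exact absurd hab (by simp [Fin.last])
  have hrange : ∀ i, m i ∈ ⋃ k, G k := by
    intro i
    refine Fin.cases ?_ (fun k => ?_) i
    · exact mem_iUnion.2 ⟨0, (hends 0).1⟩
    · exact mem_iUnion.2 ⟨k, (hends k).2⟩
  refine ⟨hrange _, hrange _, fun s hs => ?_, iUnion_subset fun k => ?_⟩
  · obtain ⟨i, rfl⟩ := hS hs
    exact hrange i
  · exact (macroGrid_bounds hβ hJ (hm Fin.castSucc_lt_succ).le (hG k)).2.trans (Icc_subset_Icc (hm.monotone (Fin.zero_le _)) (hm.monotone (Fin.le_last _)))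

/-- The elements of a graded mesh have length at most `β h` times the length of the domain, and those
touching the set towards which the mesh is graded have length at most `h ^ β` times it. -/
lemma IsGradedMesh.length_le (hβ : 1 ≤ β) (hJ : 1 ≤ J) (hab : a < b)
    (h : IsGradedMesh a b β J S N) {p q : ℝ} (hp : p ∈ N) (hq : q ∈ N) (hpq : p < q)
    (hd : Disjoint (Ioo p q) N) :
    q - p ≤ (b - a) * (β * (1 / J)) ∧ (p ∈ S ∨ q ∈ S → q - p ≤ (b - a) * (1 / J) ^ β) := by
  obtain ⟨-, -, -, hNab⟩ := h.range_subset hβ hJ hab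
  have hpa := (hNab hp).1
  have hpb := hpq.trans_le (hNab hq).2
  have hnext : ∀ z ∈ N, p < z → q ≤ z := fun z hz hpz => by
    by_contra! hzq
    exact disjoint_left.1 hd ⟨hpz, hzq⟩ hz
  obtain ⟨M, m, G, hm, rfl, rfl, hS, hG, rfl⟩ := h
  obtain ⟨k, hk, hk'⟩ := exists_macroElement hpa hpb
  have hlt : ∀ i : Fin M, m i.castSucc < m i.succ := fun i => hm Fin.castSucc_lt_succ
  have hsub : ∀ i, G i ⊆ Icc (m i.castSucc) (m i.succ) := fun i =>
    (macroGrid_bounds hβ hJ (hm Fin.castSucc_lt_succ).le (hG i)).2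
  have hends : ∀ i, m i.castSucc ∈ G i ∧ m i.succ ∈ G i := fun i =>
    (macroGrid_bounds hβ hJ (hm Fin.castSucc_lt_succ).le (hG i)).1
  -- If `p` comes from the grid of an earlier macro element, it can only be the common end point,
  -- which also lies in `G k`.
  have hpk : p ∈ G k := by
    obtain ⟨i, hi⟩ := mem_iUnion.1 hp
    rcases lt_trichotomy i k with hik | rfl | hik
    · have h1 : i.succ ≤ k.castSucc := Fin.succ_le_castSucc_iff.2 hik
      obtain rfl : p = m k.castSucc :=
        le_antisymm ((hsub i hi).2.trans (hm.monotone h1)) hk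
      exact (hends k).1
    · exact hi
    · have h1 : k.succ ≤ i.castSucc := Fin.succ_le_castSucc_iff.2 hik
      exact absurd ((hm.monotone h1).trans (hsub i hi).1) (not_le.2 hk')
  have hnk : ∀ z ∈ G k, p < z → q ≤ z := fun z hz => hnext z (mem_iUnion.2 ⟨k, hz⟩)
  have hqk : q ≤ m k.succ := hnk _ (hends k).2 hk'
  have hbetween : ∀ z, m k.castSucc ≤ z → z ≤ m k.succ → z ∈ S → z = m k.castSucc ∨ z = m k.succ := by
    intro z h1 h2 hz
    obtain ⟨i, rfl⟩ := hS hz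
    rcases le_or_gt i k.castSucc with hi | hi
    · exact Or.inl (le_antisymm (hm.monotone hi) h1)
    · exact Or.inr (le_antisymm h2 (hm.monotone (Fin.castSucc_lt_iff_succ_le.1 hi)))
  have hpS : p ∈ S → p = m k.castSucc := fun h =>
    (hbetween p hk hk'.le h).resolve_right hk'.ne
  have hqS : q ∈ S → q = m k.succ := fun h =>
    (hbetween q (hk.trans hpq.le) hqk h).resolve_left (hk.trans_lt hpq).ne'
  have hJ0 : (0 : ℝ) < J := by exact_mod_cast hJ
  have hL : m k.succ - m k.castSucc ≤ m (Fin.last M) - m 0 :=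
    sub_le_sub (hm.monotone (Fin.le_last _)) (hm.monotone (Fin.zero_le _))
  have hβJ : 0 ≤ β * (1 / (J : ℝ)) := by positivity
  have hhβ : 0 ≤ (1 / (J : ℝ)) ^ β := by positivity
  -- A point of `S` in the macro element is one of its end points, and only the end towards which
  -- the grid is graded may be in `S`. The first cell there has relative length `h^β`; the remaining
  -- cases are contradictory.
  rcases hG k with ⟨hGk, hS1⟩ | ⟨hGk, hS1⟩ | ⟨hGk, hS1, hS2⟩ <;> rw [hGk] at hpk hnk
  · obtain ⟨h1, h2⟩ := length_le_of_gradedGrid_left hβ hJ (hlt k) hpk hk' hnk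
    refine ⟨h1.trans (by gcongr), ?_⟩
    rintro (hp | hq)
    · exact (h2 (hpS hp)).trans (by gcongr)
    · exact absurd (hqS hq ▸ hq) hS1
  · obtain ⟨h1, h2⟩ := length_le_of_gradedGrid_right hβ hJ (hlt k) hpk hk' hnk
    refine ⟨h1.trans (by gcongr), ?_⟩
    rintro (hp | hq)
    · exact absurd (hpS hp ▸ hp) hS1
    · exact (h2 (hqS hq)).trans (by gcongr)
  · obtain ⟨h1, -⟩ := length_le_of_gradedGrid_left le_rfl hJ (hlt k) hpk hk' hnk
    refine ⟨h1.trans (by gcongr), ?_⟩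
    rintro (hp | hq)
    · exact absurd (hpS hp ▸ hp) hS1
    · exact absurd (hqS hq ▸ hq) hS2

end Mesh

/-! ### Nodal interpolation -/

/-- The continuous piecewise affine function with values `c k` at the nodes `x k`, `k ≤ n`. -/
def interpolant (x : ℕ → ℝ) (n : ℕ) (c : ℕ → ℝ) (y : ℝ) : ℝ :=
  c 0 + ∑ k ∈ Finset.range n,
    (c (k + 1) - c k) / (x (k + 1) - x k) * (max (x k) (min y (x (k + 1))) - x k)

section Interpolant

variable {x c : ℕ → ℝ} {n : ℕ}

lemma continuous_interpolant : Continuous (interpolant x n c) := by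
  unfold interpolant
  fun_prop

lemma interpolant_eq (hx : StrictMono x) {j : ℕ} (hj : j < n) {y : ℝ}
    (hy : y ∈ Icc (x j) (x (j + 1))) :
    interpolant x n c y = c j + (c (j + 1) - c j) / (x (j + 1) - x j) * (y - x j) := by
  unfold interpolant
  -- Ramps to the left of `y` are complete and telescope to `c j - c 0`; those to the right have not
  -- started.
  have h1 : ∀ k ∈ Finset.range j,
      (c (k + 1) - c k) / (x (k + 1) - x k) * (max (x k) (min y (x (k + 1))) - x k) =
        c (k + 1) - c k := by
    intro k hk
    have hkj : x (k + 1) ≤ x j := hx.monotone (Finset.mem_range.1 hk)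
    have hk' : x k < x (k + 1) := hx (Nat.lt_succ_self k)
    rw [min_eq_right (hkj.trans hy.1), max_eq_right hk'.le,
      div_mul_cancel₀ _ (sub_pos.2 hk').ne']
  have h2 : ∀ k ∈ Finset.Ico (j + 1) n,
      (c (k + 1) - c k) / (x (k + 1) - x k) * (max (x k) (min y (x (k + 1))) - x k) = 0 := by
    intro k hk
    have hkj : x (j + 1) ≤ x k := hx.monotone (Finset.mem_Ico.1 hk).1
    rw [max_eq_left ((min_le_left _ _).trans (hy.2.trans hkj)), sub_self, mul_zero]
  rw [← Finset.sum_range_add_sum_Ico _ (Nat.succ_le_of_lt hj), Finset.sum_eq_zero h2,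
    Finset.sum_range_succ, Finset.sum_congr rfl h1, Finset.sum_range_sub, min_eq_left hy.2,
    max_eq_right hy.1]
  ring

lemma interpolant_node (hx : StrictMono x) (hn : 0 < n) {j : ℕ} (hj : j ≤ n) :
    interpolant x n c (x j) = c j := by
  rcases hj.lt_or_eq with h | rfl
  · rw [interpolant_eq hx h (left_mem_Icc.2 (hx (Nat.lt_succ_self j)).le)]; ring
  · obtain ⟨i, rfl⟩ : ∃ i, j = i + 1 := Nat.exists_eq_succ_of_ne_zero hn.ne'
    have hi : x i < x (i + 1) := hx (Nat.lt_succ_self i)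
    rw [interpolant_eq hx (Nat.lt_succ_self i) (right_mem_Icc.2 hi.le),
      div_mul_cancel₀ _ (sub_pos.2 hi).ne']
    ring

lemma interpolant_eq_convexComb (hx : StrictMono x) {j : ℕ} (hj : j < n) {y : ℝ}
    (hy : y ∈ Icc (x j) (x (j + 1))) :
    ∃ θ ∈ Icc (0 : ℝ) 1, interpolant x n c y = (1 - θ) * c j + θ * c (j + 1) := by
  have h : 0 < x (j + 1) - x j := sub_pos.2 (hx (Nat.lt_succ_self j))
  refine ⟨(y - x j) / (x (j + 1) - x j), ⟨div_nonneg (sub_nonneg.2 hy.1) h.le, ?_⟩, ?_⟩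
  · rw [div_le_one h]; linarith [hy.2]
  · rw [interpolant_eq hx hj hy]; ring

/-- Used with `t = 0` to bound the interpolant, and with `t = v y` for its error on elements near
jumps. -/
lemma abs_sub_interpolant_le (hx : StrictMono x) {j : ℕ} (hj : j < n) {y : ℝ}
    (hy : y ∈ Icc (x j) (x (j + 1))) {t r : ℝ} (h0 : |t - c j| ≤ r) (h1 : |t - c (j + 1)| ≤ r) :
    |t - interpolant x n c y| ≤ r := by
  obtain ⟨θ, hθ, h⟩ := interpolant_eq_convexComb (c := c) hx hj hy
  rw [h]
  have h2 : t - ((1 - θ) * c j + θ * c (j + 1)) =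
      (1 - θ) * (t - c j) + θ * (t - c (j + 1)) := by ring
  rw [h2]
  calc |(1 - θ) * (t - c j) + θ * (t - c (j + 1))|
      ≤ |(1 - θ) * (t - c j)| + |θ * (t - c (j + 1))| := abs_add_le _ _
    _ = (1 - θ) * |t - c j| + θ * |t - c (j + 1)| := by
        rw [abs_mul, abs_mul, abs_of_nonneg hθ.1, abs_of_nonneg (sub_nonneg.2 hθ.2)]
    _ ≤ (1 - θ) * r + θ * r := by
        have := sub_nonneg.2 hθ.2
        have := hθ.1
        gcongr
    _ = r := by ring

/-- Affine pieces have variation at most Lipschitz constant times length, which is the nodal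
increment. -/
lemma eVariationOn_interpolant_le (hx : StrictMono x) :
    eVariationOn (interpolant x n c) (Icc (x 0) (x n)) ≤
      ∑ k ∈ Finset.range n, edist (c (k + 1)) (c k) := by
  rw [← eVariationOn.sum' _ hx.monotone]
  refine Finset.sum_le_sum fun k hk => ?_
  have hk' : x k < x (k + 1) := hx (Nat.lt_succ_self k)
  set σ := (c (k + 1) - c k) / (x (k + 1) - x k) with hσ
  have h1 : EqOn (interpolant x n c) (fun y => c k + σ * (y - x k)) (Icc (x k) (x (k + 1))) :=
    fun y hy => interpolant_eq hx (Finset.mem_range.1 hk) hy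
  rw [eVariationOn.congr h1]
  have hlip : LipschitzOnWith ‖σ‖₊ (fun y => c k + σ * (y - x k)) univ := by
    refine LipschitzOnWith.of_dist_le_mul fun y _ z _ => ?_
    rw [Real.dist_eq, Real.dist_eq, coe_nnnorm, Real.norm_eq_abs, ← abs_mul]
    exact le_of_eq (by congr 1; ring)
  have h2 := hlip.comp_eVariationOn_le (g := id) (s := Icc (x k) (x (k + 1)))
    (fun _ _ => mem_univ _)
  refine h2.trans ?_
  have h3 := (monotone_id.monotoneOn (Icc (x k) (x (k + 1)))).eVariationOn_eq
    (left_mem_Icc.2 hk'.le) (right_mem_Icc.2 hk'.le)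
  rw [inter_self] at h3
  rw [h3, edist_dist, Real.dist_eq, ← enorm_eq_nnnorm, ← ofReal_norm,
    ← ENNReal.ofReal_mul (norm_nonneg _)]
  apply ENNReal.ofReal_le_ofReal
  simp only [id]
  rw [Real.norm_eq_abs, hσ, abs_div, abs_of_pos (sub_pos.2 hk'),
    div_mul_cancel₀ _ (sub_pos.2 hk').ne']

lemma interpolant_mem_p1Space (hx : StrictMono x) (hn : 0 < n) {Γ : Set ℝ}
    (hΓ : Γ ⊆ {x 0, x n}) (h0 : x 0 ∈ Γ → c 0 = 0) (h1 : x n ∈ Γ → c n = 0) :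
    interpolant x n c ∈ p1Space (x 0) (x n) Γ (x '' Iic n) := by
  refine ⟨continuous_interpolant.continuousOn, ?_, fun z hz => ?_⟩
  · rintro _ ⟨i, hi, rfl⟩ _ ⟨j, hj, rfl⟩ hij hd
    have hij' : i < j := hx.lt_iff_lt.1 hij
    have hj' : j = i + 1 := by
      by_contra hne
      have hlt : i + 1 < j := by omega
      have hmem : x (i + 1) ∈ Ioo (x i) (x j) := ⟨hx (Nat.lt_succ_self i), hx hlt⟩
      exact Set.disjoint_left.1 hd hmem ⟨i + 1, hlt.le.trans hj, rfl⟩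
    subst hj'
    refine ⟨(c (i + 1) - c i) / (x (i + 1) - x i),
      c i - (c (i + 1) - c i) / (x (i + 1) - x i) * x i, fun y hy => ?_⟩
    rw [interpolant_eq hx hj hy]; ring
  · rcases hΓ hz with h | h
    · rw [h, interpolant_node hx hn (Nat.zero_le n)]; exact h0 (h ▸ hz)
    · rw [h, interpolant_node hx hn le_rfl]; exact h1 (h ▸ hz)

end Interpolant

/-! ### Good representatives and the interpolation error -/

section Piecewise

variable {x : ℕ → ℝ} {n : ℕ}

lemma exists_mem_Ico_node {y : ℝ} (hy : y ∈ Ico (x 0) (x n)) :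
    ∃ k < n, y ∈ Ico (x k) (x (k + 1)) := by
  induction n with
  | zero => simp at hy
  | succ n ih =>
    rcases lt_or_ge y (x n) with h | h
    · obtain ⟨k, hk, hk'⟩ := ih ⟨hy.1, h⟩
      exact ⟨k, hk.trans (Nat.lt_succ_self n), hk'⟩
    · exact ⟨n, Nat.lt_succ_self n, h, hy.2⟩

lemma sum_lintegral_Ioo_node (hx : StrictMono x) (F : ℝ → ℝ≥0∞) :
    ∑ k ∈ Finset.range n, ∫⁻ y in Ioo (x k) (x (k + 1)), F y = ∫⁻ y in Ioo (x 0) (x n), F y := by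
  have h : ∀ s t : ℝ, ∫⁻ y in Ioo s t, F y = ∫⁻ y in Ico s t, F y := fun s t => by
    rw [Measure.restrict_congr_set Ioo_ae_eq_Ico]
  simp_rw [h]
  induction n with
  | zero => simp
  | succ n ih =>
    rw [Finset.sum_range_succ, ih, ← lintegral_union measurableSet_Ico,
      Ico_union_Ico_eq_Ico (hx.monotone (Nat.zero_le n)) (hx.monotone (Nat.le_succ n))]
    rw [Set.disjoint_left]
    exact fun z h1 h2 => not_le.2 h1.2 h2.1

/-- The function which equals `f k` on `[x k, x (k + 1))` for `k < m` and `f m` on `[x m, ∞)`. -/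
def piecewiseFun (x : ℕ → ℝ) (m : ℕ) (f : ℕ → ℝ → ℝ) (y : ℝ) : ℝ :=
  f (Nat.findGreatest (fun k => x k ≤ y) m) y

variable {m : ℕ} {f : ℕ → ℝ → ℝ}

lemma piecewiseFun_eq (hx : StrictMono x) {k : ℕ} (hk : k ≤ m) {y : ℝ}
    (hy : y ∈ Ico (x k) (x (k + 1))) : piecewiseFun x m f y = f k y := by
  have h : Nat.findGreatest (fun k => x k ≤ y) m = k := by
    rw [Nat.findGreatest_eq_iff]
    refine ⟨hk, fun _ => hy.1, fun j hj _ => not_le.2 (hy.2.trans_le (hx.monotone hj))⟩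
  rw [piecewiseFun, h]

lemma piecewiseFun_eq_last {y : ℝ} (hy : x m ≤ y) : piecewiseFun x m f y = f m y := by
  have h : Nat.findGreatest (fun k => x k ≤ y) m = m := Nat.findGreatest_eq hy
  rw [piecewiseFun, h]

lemma continuousWithinAt_piecewiseFun (hx : StrictMono x) (hf : ∀ k ≤ m, Continuous (f k)) {y : ℝ}
    (hy : y ∈ Ico (x 0) (x (m + 1))) : ContinuousWithinAt (piecewiseFun x m f) (Ici y) y := by
  obtain ⟨k, hk, hk'⟩ := exists_mem_Ico_node hy
  have hkm : k ≤ m := Nat.lt_succ_iff.1 hk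
  refine (hf k hkm).continuousWithinAt.congr_of_eventuallyEq ?_ (piecewiseFun_eq hx hkm hk')
  filter_upwards [Ico_mem_nhdsGE hk'.2] with z hz
  exact piecewiseFun_eq hx hkm ⟨hk'.1.trans hz.1, hz.2⟩

lemma continuousAt_piecewiseFun_last (hf : Continuous (f m)) {y : ℝ} (hy : x m < y) :
    ContinuousAt (piecewiseFun x m f) y := by
  refine hf.continuousAt.congr ?_
  filter_upwards [Ioi_mem_nhds hy] with z hz
  exact (piecewiseFun_eq_last (le_of_lt hz)).symm

lemma ae_eq_piecewiseFun (hx : StrictMono x) {u : ℝ → ℝ}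
    (h : ∀ k ≤ m, u =ᵐ[volume.restrict (Ioo (x k) (x (k + 1)))] f k) :
    u =ᵐ[volume.restrict (Ioo (x 0) (x (m + 1)))] piecewiseFun x m f := by
  have h1 : ∀ᵐ y, ∀ k, k ≤ m → y ∈ Ioo (x k) (x (k + 1)) → u y = f k y := by
    rw [ae_all_iff]
    intro k
    by_cases hk : k ≤ m
    · have h2 := h k hk
      rw [EventuallyEq, ae_restrict_iff' measurableSet_Ioo] at h2
      exact h2.mono fun y hy _ => hy
    · exact Eventually.of_forall fun y hk' => absurd hk' hk
  have h2 : ∀ᵐ y, y ∉ range x := (countable_range x).ae_notMem volume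
  rw [EventuallyEq, ae_restrict_iff' measurableSet_Ioo]
  filter_upwards [h1, h2] with y hy1 hy2 hy
  obtain ⟨k, hk, hk'⟩ := exists_mem_Ico_node ⟨hy.1.le, hy.2⟩
  have hkm : k ≤ m := Nat.lt_succ_iff.1 hk
  rw [piecewiseFun_eq hx hkm hk']
  exact hy1 k hkm ⟨hk'.1.lt_of_ne fun h => hy2 ⟨k, h⟩, hk'.2⟩

end Piecewise

/-- The error of affine interpolation of a `C¹` function. -/
lemma enorm_sub_affine_le {f V : ℝ → ℝ} (hf : ∀ y, HasDerivAt f (V y) y) {W : ℝ≥0∞}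
    (hV : ∀ y z, ‖V y - V z‖ₑ ≤ W) {p q : ℝ} (hpq : p < q) {y : ℝ} (hy : y ∈ Icc p q) :
    ‖f y - (f p + (f q - f p) / (q - p) * (y - p))‖ₑ ≤ ENNReal.ofReal (q - p) * W := by
  have hfc : Continuous f := continuous_iff_continuousAt.2 fun z => (hf z).continuousAt
  obtain ⟨ξ, -, hξ⟩ := exists_hasDerivAt_eq_slope f V hpq hfc.continuousOn fun z _ => hf z
  rcases hy.1.eq_or_lt with rfl | hpy
  · simp
  obtain ⟨η, -, hη⟩ := exists_hasDerivAt_eq_slope f V hpy hfc.continuousOn fun z _ => hf z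
  have h1 : f y - (f p + (f q - f p) / (q - p) * (y - p)) = (y - p) * (V η - V ξ) := by
    have h2 : (y - p) * V η = f y - f p := by
      rw [hη, mul_div_cancel₀ _ (sub_pos.2 hpy).ne']
    rw [hξ]; linear_combination -h2
  rw [h1, enorm_mul]
  gcongr
  · rw [Real.enorm_of_nonneg (sub_nonneg.2 hy.1)]
    exact ENNReal.ofReal_le_ofReal (by linarith [hy.2])
  · exact hV _ _

/-- `v` is a representative of `u` on the interval of the nodes `x 0, …, x n` which is one-sided
continuous, and `C¹` on each element with a jump only at nodes in `S`. The oscillation of the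
derivative on each element is controlled by `w`. -/
structure IsGoodRepresentative (x : ℕ → ℝ) (n : ℕ) (S : Set ℝ) (u w v : ℝ → ℝ) : Prop where
  ae_eq : u =ᵐ[volume.restrict (Ioo (x 0) (x n))] v
  right_cont : ∀ y ∈ Ico (x 0) (x n), ContinuousWithinAt v (Ici y) y
  left_cont : ContinuousWithinAt v (Iic (x n)) (x n)
  element : ∀ k < n, ∃ f V : ℝ → ℝ, (∀ y, HasDerivAt f (V y) y) ∧
    (∀ y z, ‖V y - V z‖ₑ ≤ ∫⁻ t in Ioo (x k) (x (k + 1)), ‖w t‖ₑ) ∧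
    EqOn v f (Ico (x k) (x (k + 1))) ∧ (x (k + 1) ∉ S → v (x (k + 1)) = f (x (k + 1)))

/-- Glue the `C¹` representatives of the elements. At an interior node the one-sided limits are the
values of the adjacent pieces; if these differ, the node is a jump point. -/
lemma MemW21.exists_isGoodRepresentative {x : ℕ → ℝ} {m : ℕ} (hx : StrictMono x)
    {u w : ℝ → ℝ} {U : Set ℝ} (hU : MeasurableSet U) (h : MemW21 U u w)
    (hs : ∀ k ≤ m, Ioo (x k) (x (k + 1)) ⊆ U) :
    ∃ v, IsGoodRepresentative x (m + 1) (jumpSet (x 0) (x (m + 1)) u) u w v := by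
  have hlt : ∀ k, x k < x (k + 1) := fun k => hx (Nat.lt_succ_self k)
  have hex : ∀ k, ∃ f V : ℝ → ℝ, k ≤ m → (∀ y, HasDerivAt f (V y) y) ∧
      u =ᵐ[volume.restrict (Ioo (x k) (x (k + 1)))] f ∧
      ∀ y z, ‖V y - V z‖ₑ ≤ ∫⁻ t in Ioo (x k) (x (k + 1)), ‖w t‖ₑ := by
    intro k
    by_cases hk : k ≤ m
    · obtain ⟨f, V, h⟩ := h.exists_regular_representative hU (hlt k) (hs k hk)
      exact ⟨f, V, fun _ => h⟩
    · exact ⟨0, 0, fun h => absurd h hk⟩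
  choose f V hfV using hex
  have hfc : ∀ k ≤ m, Continuous (f k) := fun k hk =>
    continuous_iff_continuousAt.2 fun z => ((hfV k hk).1 z).continuousAt
  refine ⟨piecewiseFun x m f, ae_eq_piecewiseFun hx fun k hk => (hfV k hk).2.1,
    fun y hy => continuousWithinAt_piecewiseFun hx hfc hy,
    (continuousAt_piecewiseFun_last (hfc m le_rfl) (hlt m)).continuousWithinAt,
    fun k hk => ?_⟩
  have hkm : k ≤ m := Nat.lt_succ_iff.1 hk
  refine ⟨f k, V k, (hfV k hkm).1, (hfV k hkm).2.2, fun y hy => piecewiseFun_eq hx hkm hy,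
    fun hS => ?_⟩
  -- At the last node the glued function simply continues with the last piece.
  rcases hkm.eq_or_lt with rfl | hlt'
  · exact piecewiseFun_eq_last (hlt k).le
  · have hk1 : k + 1 ≤ m := hlt'
    rw [piecewiseFun_eq hx hk1 (left_mem_Ico.2 (hlt (k + 1)))]
    by_contra hne
    refine hS ⟨⟨hx (Nat.succ_pos k), hx (Nat.lt_succ_of_le hk1)⟩, f k (x (k + 1)),
      f (k + 1) (x (k + 1)), Ne.symm hne, ?_, ?_⟩
    · exact hasLeftTrace_of_ae_eq (hlt k) (hfV k hkm).2.1 (hfc k hkm).continuousWithinAt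
    · exact hasRightTrace_of_ae_eq (hlt (k + 1)) (hfV _ hk1).2.1 (hfc _ hk1).continuousWithinAt

namespace IsGoodRepresentative

variable {x : ℕ → ℝ} {n : ℕ} {S : Set ℝ} {u w v : ℝ → ℝ}

lemma integrableOn (h : IsGoodRepresentative x n S u w v)
    (hu : IntegrableOn u (Ioo (x 0) (x n))) : IntegrableOn v (Ioo (x 0) (x n)) :=
  Integrable.congr hu h.ae_eq

lemma eVariationOn_le (h : IsGoodRepresentative x n S u w v)
    (hu : IntegrableOn u (Ioo (x 0) (x n))) :
    eVariationOn v (Icc (x 0) (x n)) ≤ totalVariation (x 0) (x n) u := by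
  rw [totalVariation_congr_ae h.ae_eq]
  exact eVariationOn_le_totalVariation (h.integrableOn hu) h.right_cont h.left_cont

lemma abs_le (h : IsGoodRepresentative x n S u w v) (hx : x 0 < x n) {G : ℝ}
    (hG : ∀ᵐ y ∂volume.restrict (Ioo (x 0) (x n)), |u y| ≤ G) {y : ℝ} (hy : y ∈ Icc (x 0) (x n)) :
    |v y| ≤ G := by
  have hvG : ∀ᵐ y ∂volume, y ∈ Ioo (x 0) (x n) → |v y| ≤ G := by
    rw [← ae_restrict_iff' measurableSet_Ioo]
    filter_upwards [hG, h.ae_eq] with z hz hz'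
    rwa [← hz']
  -- `A` is a side from which `v` is continuous at `y`. It has positive measure near `y`, so a
  -- violation of the bound at `y` would occur on a set of positive measure.
  have key : ∀ A : Set ℝ, (∀ s t : ℝ, s < y → y < t → volume (Ioo s t ∩ A) ≠ 0) →
      A ⊆ Ioo (x 0) (x n) → ContinuousWithinAt v A y → |v y| ≤ G := by
    intro A hA hAs hc
    by_contra! hlt
    have h1 : ∀ᶠ z in 𝓝[A] y, G < |v z| := hc.abs.eventually (lt_mem_nhds hlt)
    obtain ⟨o, ho, hyo, hsub⟩ := mem_nhdsWithin.1 h1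
    obtain ⟨s, t, hst, hst'⟩ := mem_nhds_iff_exists_Ioo_subset.1 (ho.mem_nhds hyo)
    refine hA s t hst.1 hst.2 (measure_mono_null (fun z hz => ?_) hvG)
    intro hz'
    exact absurd (hz' (hAs hz.2)) (not_le.2 (hsub ⟨hst' hz.1, hz.2⟩))
  rcases hy.2.lt_or_eq with hlt | rfl
  · refine key (Ioo y (x n)) (fun s t hs ht => ?_) (Ioo_subset_Ioo_left hy.1)
      ((h.right_cont y ⟨hy.1, hlt⟩).mono fun z hz => hz.1.le)
    rw [Ioo_inter_Ioo, max_eq_right hs.le, Real.volume_Ioo]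
    exact (ENNReal.ofReal_pos.2 (sub_pos.2 (lt_min ht hlt))).ne'
  · refine key (Ioo (x 0) (x n)) (fun s t hs ht => ?_) subset_rfl
      (h.left_cont.mono fun z hz => hz.2.le)
    rw [Ioo_inter_Ioo, min_eq_right ht.le, Real.volume_Ioo]
    exact (ENNReal.ofReal_pos.2 (sub_pos.2 (max_lt hs hx))).ne'

/-- Clear for pointwise variation, so one passes to `T ∘ v` and back; this supplies the truncation
step of the maximum principle. -/
lemma totalVariation_comp_le (h : IsGoodRepresentative x n S u w v) (hx : x 0 < x n)
    (hu : IntegrableOn u (Ioo (x 0) (x n))) {T : ℝ → ℝ} (hT : LipschitzWith 1 T)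
    (hTu : IntegrableOn (fun y => T (u y)) (Ioo (x 0) (x n))) :
    totalVariation (x 0) (x n) (fun y => T (u y)) ≤ totalVariation (x 0) (x n) u := by
  have hae : (fun y => T (u y)) =ᵐ[volume.restrict (Ioo (x 0) (x n))] T ∘ v :=
    h.ae_eq.mono fun y hy => by simp [hy]
  rw [totalVariation_congr_ae hae]
  refine (totalVariation_le_eVariationOn hx (Integrable.congr hTu hae)).trans ?_
  refine le_trans ?_ (h.eVariationOn_le hu)
  simpa using (hT.lipschitzOnWith (s := univ)).comp_eVariationOn_le (g := v)
    (s := Icc (x 0) (x n)) fun _ _ => mem_univ _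

lemma totalVariation_interpolant_le (h : IsGoodRepresentative x n S u w v) (hx : StrictMono x)
    (hn : 0 < n) (hu : IntegrableOn u (Ioo (x 0) (x n))) :
    totalVariation (x 0) (x n) (interpolant x n fun k => v (x k)) ≤
      totalVariation (x 0) (x n) u := by
  refine (totalVariation_le_eVariationOn (hx hn)
    (continuous_interpolant.integrableOn_Icc.mono_set Ioo_subset_Icc_self)).trans ?_
  refine (eVariationOn_interpolant_le hx).trans (le_trans ?_ (h.eVariationOn_le hu))
  exact eVariationOn.sum_le_of_monotoneOn_Iic (hx.monotone.monotoneOn _) fun i hi =>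
    ⟨hx.monotone (Nat.zero_le i), hx.monotone hi⟩

/-- The `L¹` error of nodal interpolation on a mesh whose elements have length at most `δ`, and
at most `ρ` if they touch the jump set. -/
lemma lintegral_sub_interpolant_le (h : IsGoodRepresentative x n S u w v) (hx : StrictMono x)
    {δ ρ : ℝ} (hδ : ∀ k < n, x (k + 1) - x k ≤ δ)
    (hρ : ∀ k < n, x k ∈ S ∨ x (k + 1) ∈ S → x (k + 1) - x k ≤ ρ) :
    ∫⁻ y in Ioo (x 0) (x n), ‖u y - interpolant x n (fun k => v (x k)) y‖ₑ ≤
      ENNReal.ofReal ρ * eVariationOn v (Icc (x 0) (x n)) +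
        ENNReal.ofReal δ ^ 2 * ∫⁻ y in Ioo (x 0) (x n), ‖w y‖ₑ := by
  have h0 : ∫⁻ y in Ioo (x 0) (x n), ‖u y - interpolant x n (fun k => v (x k)) y‖ₑ =
      ∫⁻ y in Ioo (x 0) (x n), ‖v y - interpolant x n (fun k => v (x k)) y‖ₑ :=
    lintegral_congr_ae (h.ae_eq.mono fun y hy => by simp only [hy])
  rw [h0, ← sum_lintegral_Ioo_node hx, ← sum_lintegral_Ioo_node hx,
    ← eVariationOn.sum' _ hx.monotone, Finset.mul_sum, Finset.mul_sum, ← Finset.sum_add_distrib]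
  refine Finset.sum_le_sum fun k hk => ?_
  have hkn : k < n := Finset.mem_range.1 hk
  have hlt : x k < x (k + 1) := hx (Nat.lt_succ_self k)
  set W := ∫⁻ y in Ioo (x k) (x (k + 1)), ‖w y‖ₑ with hW
  set E := eVariationOn v (Icc (x k) (x (k + 1))) with hE
  have hbound : ∀ c : ℝ≥0∞, (∀ y ∈ Ioo (x k) (x (k + 1)),
      ‖v y - interpolant x n (fun k => v (x k)) y‖ₑ ≤ c) →
      ∫⁻ y in Ioo (x k) (x (k + 1)), ‖v y - interpolant x n (fun k => v (x k)) y‖ₑ ≤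
        ENNReal.ofReal (x (k + 1) - x k) * c := by
    intro c hc
    refine (setLIntegral_mono' measurableSet_Ioo hc).trans ?_
    rw [setLIntegral_const, Real.volume_Ioo, mul_comm]
  -- Near a jump both nodal values are within the local variation `E` of `v y`. Otherwise `v` agrees
  -- with a `C¹` function on the closed element and the affine interpolation estimate applies.
  by_cases hS : x k ∈ S ∨ x (k + 1) ∈ S
  · refine le_add_right ((hbound E fun y hy => ?_).trans ?_)
    · rcases eq_or_ne E ⊤ with hE' | hE'
      · simp [hE']
      have hd : ∀ z ∈ Icc (x k) (x (k + 1)), |v y - v z| ≤ E.toReal := by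
        intro z hz
        have h1 := eVariationOn.edist_le v (Ioo_subset_Icc_self hy) hz
        have h2 := ENNReal.toReal_mono hE' h1
        rwa [edist_dist, ENNReal.toReal_ofReal dist_nonneg, Real.dist_eq] at h2
      rw [← ofReal_norm, Real.norm_eq_abs, ENNReal.ofReal_le_iff_le_toReal hE']
      exact abs_sub_interpolant_le hx hkn (Ioo_subset_Icc_self hy)
        (hd _ (left_mem_Icc.2 hlt.le)) (hd _ (right_mem_Icc.2 hlt.le))
    · gcongr
      exact hρ k hkn hS
  · rw [not_or] at hS
    refine le_add_left ((hbound (ENNReal.ofReal (x (k + 1) - x k) * W) fun y hy => ?_).trans ?_)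
    · obtain ⟨f, V, hf, hV, hvf, hvf'⟩ := h.element k hkn
      rw [interpolant_eq hx hkn (Ioo_subset_Icc_self hy), hvf' hS.2,
        hvf (left_mem_Ico.2 hlt), hvf (Ioo_subset_Ico_self hy)]
      exact enorm_sub_affine_le hf hV hlt (Ioo_subset_Icc_self hy)
    · rw [← mul_assoc, ← sq]
      gcongr
      exact hδ k hkn

end IsGoodRepresentative

/-! ### Maximum principle and quasi-optimality -/

lemma ae_abs_le_eLpNorm_top {μ : Measure ℝ} {g : ℝ → ℝ} (hg : MemLp g ⊤ μ) :
    ∀ᵐ y ∂μ, |g y| ≤ (eLpNorm g ⊤ μ).toReal := by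
  have h := enorm_ae_le_eLpNormEssSup g μ
  rw [← eLpNorm_exponent_top] at h
  filter_upwards [h] with y hy
  have := ENNReal.toReal_mono hg.eLpNorm_ne_top hy
  rwa [toReal_enorm, Real.norm_eq_abs] at this

/-- The truncation of real numbers to `[-G, G]`. -/
def truncation (G y : ℝ) : ℝ := max (-G) (min y G)

lemma lipschitzWith_truncation (G : ℝ) : LipschitzWith 1 (truncation G) :=
  (LipschitzWith.id.min_const G).const_max (-G)

lemma abs_truncation_le {G : ℝ} (hG : 0 ≤ G) (y : ℝ) : |truncation G y| ≤ G :=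
  abs_le.2 ⟨le_max_left _ _, max_le (by linarith) (min_le_right _ _)⟩

lemma abs_truncation_le_abs {G : ℝ} (hG : 0 ≤ G) (y : ℝ) : |truncation G y| ≤ |y| := by
  have h := (lipschitzWith_truncation G).dist_le_mul y 0
  have h0 : truncation G 0 = 0 := by simp [truncation, hG]
  simpa [h0, Real.dist_eq] using h

lemma sq_sub_truncation_le {G t : ℝ} (ht : |t| ≤ G) (y : ℝ) :
    (t - truncation G y) ^ 2 ≤ (t - y) ^ 2 := by
  have h := (lipschitzWith_truncation G).dist_le_mul t y
  obtain ⟨h1, h2⟩ := abs_le.1 ht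
  have h0 : truncation G t = t := by rw [truncation, min_eq_left h2, max_eq_right h1]
  rw [h0, NNReal.coe_one, one_mul, Real.dist_eq, Real.dist_eq] at h
  exact sq_le_sq.2 h

section Minimizer

variable {a b α : ℝ} {Γ : Set ℝ} {g u : ℝ → ℝ}

lemma truncation_mem_admissible (hab : a < b) {G : ℝ} (hG : 0 ≤ G) (hu : u ∈ admissible a b Γ)
    (ht : totalVariation a b (fun y => truncation G (u y)) ≤ totalVariation a b u) :
    (fun y => truncation G (u y)) ∈ admissible a b Γ := by
  obtain ⟨⟨hu1, hut⟩, hu2, hua, hub⟩ := hu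
  have huI : IntegrableOn u (Ioo a b) := memLp_one_iff_integrable.1 hu1
  have hle : ∀ y, |truncation G (u y)| ≤ |u y| + |u y| := fun y =>
    (abs_truncation_le_abs hG _).trans (by linarith [abs_nonneg (u y)])
  have hmeas : AEStronglyMeasurable (fun y => truncation G (u y)) (volume.restrict (Ioo a b)) :=
    (lipschitzWith_truncation G).continuous.comp_aestronglyMeasurable hu1.1
  have hlp : ∀ {p : ℝ≥0∞}, MemLp u p (volume.restrict (Ioo a b)) →
      MemLp (fun y => truncation G (u y)) p (volume.restrict (Ioo a b)) := fun h =>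
    h.mono hmeas (Eventually.of_forall fun y => abs_truncation_le_abs hG _)
  exact ⟨⟨hlp hu1, ht.trans_lt hut⟩, hlp hu2,
    fun h => hasRightTrace_zero_of_le hab huI huI hle (hua h) (hua h),
    fun h => hasLeftTrace_zero_of_le hab huI huI hle (hub h) (hub h)⟩

/-- The maximum principle for minimizers. -/
lemma IsMinimizer.ae_abs_le (hab : a < b) (hα : 0 < α)
    (hg : MemLp g 2 (volume.restrict (Ioo a b))) (hu : IsMinimizer a b α Γ g u) {G : ℝ}
    (hG : 0 ≤ G) (hgG : ∀ᵐ y ∂volume.restrict (Ioo a b), |g y| ≤ G)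
    (ht : totalVariation a b (fun y => truncation G (u y)) ≤ totalVariation a b u) :
    ∀ᵐ y ∂volume.restrict (Ioo a b), |u y| ≤ G := by
  have hw := truncation_mem_admissible hab hG hu.1 ht
  have h1 := hu.integral_sq_le hab hα hg hw
  have hd : Integrable (fun y => (u y - truncation G (u y)) ^ 2) (volume.restrict (Ioo a b)) :=
    (hu.1.2.1.sub hw.2.1).integrable_sq
  -- Truncation at the level of `g` increases neither term of the energy, so quantitative uniqueness
  -- forces `u` to equal its truncation almost everywhere.
  have h2 : ∫ y in Ioo a b, (g y - truncation G (u y)) ^ 2 ≤ ∫ y in Ioo a b, (g y - u y) ^ 2 :=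
    integral_mono_ae (hg.sub hw.2.1).integrable_sq (hg.sub hu.1.2.1).integrable_sq
      (hgG.mono fun y hy => sq_sub_truncation_le hy _)
  have h3 := ENNReal.toReal_mono hu.1.1.2.ne ht
  have h4 : ∫ y in Ioo a b, (u y - truncation G (u y)) ^ 2 ≤ 0 := by
    unfold realEnergy at h1
    nlinarith
  have h5 := (integral_eq_zero_iff_of_nonneg (fun y => sq_nonneg _) hd).1
    (le_antisymm h4 (integral_nonneg fun y => sq_nonneg _))
  filter_upwards [h5] with y hy
  have h6 : u y = truncation G (u y) := sub_eq_zero.1 (pow_eq_zero_iff two_ne_zero |>.1 hy)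
  rw [h6]
  exact abs_truncation_le hG _

/-- The fidelity difference factors as `(2g - u - v)(u - v)`, and the first factor is at most `4G`.
-/
lemma realEnergy_sub_le (hα : 0 < α) (hg : MemLp g 2 (volume.restrict (Ioo a b))) {v : ℝ → ℝ}
    (hu : MemLp u 2 (volume.restrict (Ioo a b))) (hv : MemLp v 2 (volume.restrict (Ioo a b)))
    (hut : totalVariation a b u ≠ ⊤) (ht : totalVariation a b v ≤ totalVariation a b u) {G : ℝ}
    (hgG : ∀ᵐ y ∂volume.restrict (Ioo a b), |g y| ≤ G)
    (huG : ∀ᵐ y ∂volume.restrict (Ioo a b), |u y| ≤ G)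
    (hvG : ∀ᵐ y ∂volume.restrict (Ioo a b), |v y| ≤ G) :
    realEnergy a b α g v - realEnergy a b α g u ≤
      α / 2 * (4 * G * ∫ y in Ioo a b, |u y - v y|) := by
  have h1 := ENNReal.toReal_mono hut ht
  have hI : Integrable (fun y => |u y - v y|) (volume.restrict (Ioo a b)) :=
    ((hu.sub hv).integrable one_le_two).abs
  have hIv : Integrable (fun y => (g y - v y) ^ 2) (volume.restrict (Ioo a b)) :=
    (hg.sub hv).integrable_sq
  have hIu : Integrable (fun y => (g y - u y) ^ 2) (volume.restrict (Ioo a b)) :=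
    (hg.sub hu).integrable_sq
  have h2 : (∫ y in Ioo a b, (g y - v y) ^ 2) - ∫ y in Ioo a b, (g y - u y) ^ 2 ≤
      4 * G * ∫ y in Ioo a b, |u y - v y| := by
    rw [← integral_sub hIv hIu, ← integral_const_mul]
    apply integral_mono_ae (hIv.sub hIu) (hI.const_mul _)
    filter_upwards [hgG, huG, hvG] with y hy1 hy2 hy3
    have h3 : (g y - v y) ^ 2 - (g y - u y) ^ 2 = (2 * g y - u y - v y) * (u y - v y) := by ring
    have h4 : |2 * g y - u y - v y| ≤ 4 * G := by
      rw [abs_le] at *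
      constructor <;> linarith
    rw [Pi.sub_apply, h3]
    calc (2 * g y - u y - v y) * (u y - v y) ≤ |2 * g y - u y - v y| * |u y - v y| := by
          rw [← abs_mul]; exact le_abs_self _
      _ ≤ 4 * G * |u y - v y| := by gcongr
  have h5 := mul_le_mul_of_nonneg_left h2 (by positivity : 0 ≤ α / 2)
  unfold realEnergy
  linarith

lemma memLp_of_continuousOn {v : ℝ → ℝ} (hv : ContinuousOn v (Icc a b)) (p : ℝ≥0∞) :
    MemLp v p (volume.restrict (Ioo a b)) := by
  obtain ⟨C, hC⟩ := isCompact_Icc.exists_bound_of_continuousOn hv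
  refine MemLp.of_bound ((hv.mono Ioo_subset_Icc_self).aestronglyMeasurable measurableSet_Ioo) C ?_
  filter_upwards [ae_restrict_mem measurableSet_Ioo] with y hy
  exact hC y (Ioo_subset_Icc_self hy)

lemma mem_admissible_of_mem_p1Space (hab : a < b) {N : Set ℝ} {v : ℝ → ℝ}
    (hv : v ∈ p1Space a b Γ N) (ht : totalVariation a b v < ⊤) : v ∈ admissible a b Γ := by
  obtain ⟨hc, -, h0⟩ := hv
  refine ⟨⟨memLp_of_continuousOn hc 1, ht⟩, memLp_of_continuousOn hc 2, fun h => ?_, fun h => ?_⟩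
  · have := hasRightTrace_of_ae_eq hab (ae_eq_refl v) (hc a (left_mem_Icc.2 hab.le))
    rwa [h0 a h] at this
  · have := hasLeftTrace_of_ae_eq hab (ae_eq_refl v) (hc b (right_mem_Icc.2 hab.le))
    rwa [h0 b h] at this

/-- Quasi-optimality of the `P1` minimizer in terms of an `L¹` error. -/
lemma IsMinimizer.eLpNorm_sub_sq_le (hab : a < b) (hα : 0 < α)
    (hg : MemLp g ⊤ (volume.restrict (Ioo a b))) (hu : IsMinimizer a b α Γ g u)
    (huG : ∀ᵐ y ∂volume.restrict (Ioo a b),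
      |u y| ≤ (eLpNorm g ⊤ (volume.restrict (Ioo a b))).toReal)
    {N : Set ℝ} {uh v : ℝ → ℝ} (huh : IsP1Minimizer a b α Γ N g uh) (hv : v ∈ p1Space a b Γ N)
    (ht : totalVariation a b v ≤ totalVariation a b u)
    (hvG : ∀ y ∈ Icc a b, |v y| ≤ (eLpNorm g ⊤ (volume.restrict (Ioo a b))).toReal) :
    eLpNorm (fun y => u y - uh y) 2 (volume.restrict (Ioo a b)) ^ 2 ≤
      8 * eLpNorm g ⊤ (volume.restrict (Ioo a b)) * ∫⁻ y in Ioo a b, ‖u y - v y‖ₑ := by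
  set G := (eLpNorm g ⊤ (volume.restrict (Ioo a b))).toReal with hG
  have hG0 : 0 ≤ G := ENNReal.toReal_nonneg
  have hg2 : MemLp g 2 (volume.restrict (Ioo a b)) := hg.mono_exponent le_top
  have hut := hu.1.1.2
  have hv2 := memLp_of_continuousOn hv.1 2
  have h1 := huh.2 hv
  simp only [mem_ofPred_eq] at h1
  rw [energy_eq_ofReal hα hg2 hv2 (ht.trans_lt hut).ne] at h1
  -- Finiteness comes from comparing energies with the competitor `v`.
  have huht : totalVariation a b uh < ⊤ :=
    (le_self_add.trans h1).trans_lt ENNReal.ofReal_lt_top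
  have huha := mem_admissible_of_mem_p1Space hab huh.1 huht
  rw [energy_eq_ofReal hα hg2 huha.2.1 huht.ne,
    ENNReal.ofReal_le_ofReal_iff (realEnergy_nonneg hα _ _)] at h1
  have h2 := hu.integral_sq_le hab hα hg2 huha
  have h3 := realEnergy_sub_le hα hg2 hu.1.2.1 hv2 hut.ne ht (ae_abs_le_eLpNorm_top hg) huG
    ((ae_restrict_mem measurableSet_Ioo).mono fun y hy => hvG y (Ioo_subset_Icc_self hy))
  -- Here `α` drops out, since `α/2 · 4G = α/4 · 8G`.
  have h4 : ∫ y in Ioo a b, (u y - uh y) ^ 2 ≤ 8 * G * ∫ y in Ioo a b, |u y - v y| := by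
    have h5 : α / 4 * ∫ y in Ioo a b, (u y - uh y) ^ 2 ≤
        α / 4 * (8 * G * ∫ y in Ioo a b, |u y - v y|) := by linarith
    exact le_of_mul_le_mul_left h5 (by positivity)
  have hI : Integrable (fun y => u y - v y) (volume.restrict (Ioo a b)) :=
    (hu.1.2.1.sub hv2).integrable one_le_two
  have h6 : ∫⁻ y in Ioo a b, ‖u y - v y‖ₑ = ENNReal.ofReal (∫ y in Ioo a b, |u y - v y|) :=
    (ofReal_integral_norm_eq_lintegral_enorm hI).symm
  rw [eLpNorm_two_sq_eq_ofReal (f := fun y => u y - uh y) (hu.1.2.1.sub huha.2.1), h6,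
    ← ENNReal.ofReal_toReal hg.eLpNorm_ne_top, ← hG]
  refine (ENNReal.ofReal_le_ofReal h4).trans (le_of_eq ?_)
  rw [ENNReal.ofReal_mul (by positivity), ENNReal.ofReal_mul (by norm_num)]
  simp

end Minimizer

/-- The error estimate in terms of bounds for the element lengths. -/
lemma IsMinimizer.eLpNorm_sub_sq_le_of_mesh {x : ℕ → ℝ} {m : ℕ} (hx : StrictMono x) {α : ℝ}
    (hα : 0 < α) {Γ : Set ℝ} (hΓ : Γ ⊆ {x 0, x (m + 1)}) {g u w : ℝ → ℝ}
    (hg : MemLp g ⊤ (volume.restrict (Ioo (x 0) (x (m + 1)))))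
    (hu : IsMinimizer (x 0) (x (m + 1)) α Γ g u) {U : Set ℝ} (hU : MeasurableSet U)
    (hw : MemW21 U u w) (hs : ∀ k ≤ m, Ioo (x k) (x (k + 1)) ⊆ U) {δ ρ : ℝ}
    (hδ : ∀ k < m + 1, x (k + 1) - x k ≤ δ)
    (hρ : ∀ k < m + 1, x k ∈ jumpSet (x 0) (x (m + 1)) u ∨
      x (k + 1) ∈ jumpSet (x 0) (x (m + 1)) u → x (k + 1) - x k ≤ ρ)
    {uh : ℝ → ℝ} (huh : IsP1Minimizer (x 0) (x (m + 1)) α Γ (x '' Iic (m + 1)) g uh) :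
    eLpNorm (fun y => u y - uh y) 2 (volume.restrict (Ioo (x 0) (x (m + 1)))) ^ 2 ≤
      8 * eLpNorm g ⊤ (volume.restrict (Ioo (x 0) (x (m + 1)))) *
        (ENNReal.ofReal ρ * totalVariation (x 0) (x (m + 1)) u +
          ENNReal.ofReal δ ^ 2 * ∫⁻ y in Ioo (x 0) (x (m + 1)), ‖w y‖ₑ) := by
  have hab : x 0 < x (m + 1) := hx (Nat.succ_pos m)
  obtain ⟨v, hv⟩ := hw.exists_isGoodRepresentative hx hU hs
  have huI : IntegrableOn u (Ioo (x 0) (x (m + 1))) := memLp_one_iff_integrable.1 hu.1.1.1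
  set G := (eLpNorm g ⊤ (volume.restrict (Ioo (x 0) (x (m + 1))))).toReal
  have hG0 : 0 ≤ G := ENNReal.toReal_nonneg
  have hTI : IntegrableOn (fun y => truncation G (u y)) (Ioo (x 0) (x (m + 1))) :=
    Integrable.mono huI ((lipschitzWith_truncation G).continuous.comp_aestronglyMeasurable huI.1)
      (Eventually.of_forall fun y => abs_truncation_le_abs hG0 _)
  have huG := hu.ae_abs_le hab hα (hg.mono_exponent le_top) hG0 (ae_abs_le_eLpNorm_top hg)
    (hv.totalVariation_comp_le hab huI (lipschitzWith_truncation G) hTI)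
  have hvG : ∀ y ∈ Icc (x 0) (x (m + 1)), |v y| ≤ G := fun y hy => hv.abs_le hab huG hy
  have hnode : ∀ k ≤ m + 1, |0 - v (x k)| ≤ G := fun k hk => by
    rw [zero_sub, abs_neg]
    exact hvG _ ⟨hx.monotone (Nat.zero_le k), hx.monotone hk⟩
  have hIG : ∀ y ∈ Icc (x 0) (x (m + 1)),
      |interpolant x (m + 1) (fun k => v (x k)) y| ≤ G := by
    intro y hy
    rcases hy.2.lt_or_eq with h | rfl
    · obtain ⟨k, hk, hk'⟩ := exists_mem_Ico_node ⟨hy.1, h⟩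
      have := abs_sub_interpolant_le (c := fun k => v (x k)) hx hk (Ico_subset_Icc_self hk')
        (hnode k hk.le) (hnode (k + 1) hk)
      rwa [zero_sub, abs_neg] at this
    · rw [interpolant_node hx (Nat.succ_pos m) le_rfl]
      exact hvG _ hy
  have hp1 : interpolant x (m + 1) (fun k => v (x k)) ∈
      p1Space (x 0) (x (m + 1)) Γ (x '' Iic (m + 1)) := by
    -- The boundary values of `v` are traces of `u`, hence zero on `Γ` by uniqueness of traces.
    refine interpolant_mem_p1Space hx (Nat.succ_pos m) hΓ (fun h => ?_) fun h => ?_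
    · refine HasRightTrace.unique hab huI (hasRightTrace_of_ae_eq hab hv.ae_eq ?_) (hu.1.2.2.1 h)
      exact (hv.right_cont _ (left_mem_Ico.2 hab)).mono Icc_subset_Ici_self
    · refine HasLeftTrace.unique hab huI (hasLeftTrace_of_ae_eq hab hv.ae_eq ?_) (hu.1.2.2.2 h)
      exact hv.left_cont.mono Icc_subset_Iic_self
  refine (hu.eLpNorm_sub_sq_le hab hα hg huG huh hp1
    (hv.totalVariation_interpolant_le hx (Nat.succ_pos m) huI) hIG).trans ?_
  gcongr
  exact (hv.lintegral_sub_interpolant_le hx hδ hρ).trans (by gcongr; exact hv.eVariationOn_le huI)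

end ROF1D

end

/-! ### The error estimate on graded meshes -/

theorem mainTheorem2 (a b : ℝ) (hab : a < b) :
    ∃ c : ℝ≥0, ∀ (α : ℝ) (hα : 0 < α) (Γ : Set ℝ) (hΓ : Γ ⊆ {a, b})
      (g : ℝ → ℝ) (hg : MemLp g (⊤ : ℝ≥0∞) (volume.restrict (Ioo a b)))
      (u : ℝ → ℝ) (hu : ROF1D.IsMinimizer a b α Γ g u)
      (P : Finset ℝ) (u'' : ℝ → ℝ) (hu'' : ROF1D.MemW21 (Ioo a b \ P) u u'')
      (β : ℝ) (hβ : 1 ≤ β) (J : ℕ) (hJ : 1 ≤ J)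
      (N : Set ℝ) (hN : ROF1D.IsGradedMesh a b β J (ROF1D.jumpSet a b u) N)
      (hPN : ∀ x ∈ P, x ∈ Ioo a b → x ∉ ROF1D.jumpSet a b u → x ∈ N)
      (uh : ℝ → ℝ) (huh : ROF1D.IsP1Minimizer a b α Γ N g uh),
      eLpNorm (fun x => u x - uh x) 2 (volume.restrict (Ioo a b)) ^ 2 ≤
        c * (ENNReal.ofReal ((1 / (J : ℝ)) ^ β) * ROF1D.totalVariation a b u +
            ENNReal.ofReal (β ^ 2 * (1 / (J : ℝ)) ^ 2) *
              eLpNorm u'' 1 (volume.restrict (Ioo a b \ ROF1D.jumpSet a b u))) *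
          eLpNorm g (⊤ : ℝ≥0∞) (volume.restrict (Ioo a b)) := by
  -- With `L = b - a`, the jump term needs `8 L` and the second derivative term `8 L²`.
  refine ⟨Real.toNNReal (8 * ((b - a) + (b - a) ^ 2)), ?_⟩
  intro α hα Γ hΓ g hg u hu P u'' hu'' β hβ J hJ N hN hPN uh huh
  obtain ⟨haN, hbN, hSN, hNab⟩ := hN.range_subset hβ hJ hab
  obtain ⟨x, n, hx, hxN⟩ := ROF1D.exists_strictMono_enumeration hN.finite.toFinset
    ⟨a, by simpa using haN⟩
  rw [hN.finite.coe_toFinset] at hxN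
  have hxmem : ∀ k ≤ n, x k ∈ N := fun k hk => hxN ▸ mem_image_of_mem x hk
  have hx0 : x 0 = a := by
    obtain ⟨i, -, hi⟩ := hxN ▸ haN
    exact le_antisymm (hi ▸ hx.monotone (Nat.zero_le i)) (hNab (hxmem 0 (Nat.zero_le n))).1
  have hxn : x n = b := by
    obtain ⟨i, hin, hi⟩ := hxN ▸ hbN
    exact le_antisymm (hNab (hxmem n le_rfl)).2 (hi ▸ hx.monotone hin)
  obtain ⟨m, rfl⟩ : ∃ m, n = m + 1 := by
    refine Nat.exists_eq_succ_of_ne_zero ?_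
    rintro rfl
    exact hab.ne (hx0.symm.trans hxn)
  have hlt : ∀ k, x k < x (k + 1) := fun k => hx (Nat.lt_succ_self k)
  have hdisj : ∀ k, Disjoint (Ioo (x k) (x (k + 1))) N := by
    intro k
    rw [Set.disjoint_left, hxN]
    rintro _ hy ⟨i, -, rfl⟩
    have h1 := hx.lt_iff_lt.1 hy.1
    have h2 := hx.lt_iff_lt.1 hy.2
    omega
  have hlen : ∀ k < m + 1, _ := fun k hk =>
    hN.length_le hβ hJ hab (hxmem k hk.le) (hxmem (k + 1) hk) (hlt k) (hdisj k)
  -- Every point of `P` in the domain is a vertex: jump points by the grading, the others by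
  -- assumption.
  have hUs : ∀ k ≤ m, Ioo (x k) (x (k + 1)) ⊆ Ioo a b \ P := by
    intro k hk y hy
    have hyab : y ∈ Ioo a b :=
      ⟨(hNab (hxmem k (by omega))).1.trans_lt hy.1, hy.2.trans_le (hNab (hxmem _ (by omega))).2⟩
    refine ⟨hyab, fun hyP => Set.disjoint_left.1 (hdisj k) hy ?_⟩
    by_cases hS : y ∈ ROF1D.jumpSet a b u
    · exact hSN hS
    · exact hPN y hyP hyab hS
  -- The jump set consists of vertices, so it is finite and hence null.
  have hw : eLpNorm u'' 1 (volume.restrict (Ioo a b \ ROF1D.jumpSet a b u)) =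
      ∫⁻ y in Ioo a b, ‖u'' y‖ₑ := by
    rw [eLpNorm_one_eq_lintegral_enorm, Measure.restrict_congr_set
      (sdiff_null_ae_eq_self ((hN.finite.subset hSN).measure_zero volume))]
  rw [hw]
  subst hx0 hxn hxN
  set L := x (m + 1) - x 0 with hL
  have hL0 : 0 ≤ L := sub_nonneg.2 hab.le
  refine (hu.eLpNorm_sub_sq_le_of_mesh hx hα hΓ hg (measurableSet_Ioo.diff P.measurableSet) hu''
    hUs (fun k hk => (hlen k hk).1) (fun k hk => (hlen k hk).2) huh).trans ?_
  rw [mul_comm _ (eLpNorm g _ _), mul_comm _ (eLpNorm g _ _), mul_assoc]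
  gcongr _ * ?_
  rw [mul_add, mul_add]
  have h8 : (8 : ℝ≥0∞) = ENNReal.ofReal 8 := by simp
  have hJ0 : 0 ≤ 1 / (J : ℝ) := by positivity
  have hβ0 : 0 ≤ β := by linarith
  refine add_le_add ?_ ?_ <;> rw [← mul_assoc 8, ← mul_assoc (ENNReal.ofNNReal _)] <;> gcongr ?_ * _
  · rw [h8, ← ENNReal.ofReal_mul (by norm_num)]
    change _ ≤ ENNReal.ofReal _ * _
    rw [← ENNReal.ofReal_mul (by positivity)]
    apply ENNReal.ofReal_le_ofReal
    have : 0 ≤ L ^ 2 * (1 / (J : ℝ)) ^ β := by positivity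
    linarith
  · rw [h8, ← ENNReal.ofReal_pow (by positivity), ← ENNReal.ofReal_mul (by norm_num)]
    change _ ≤ ENNReal.ofReal _ * _
    rw [← ENNReal.ofReal_mul (by positivity)]
    apply ENNReal.ofReal_le_ofReal
    have : 0 ≤ L * (β ^ 2 * (1 / (J : ℝ)) ^ 2) := by positivity
    linarith
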